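/- A $C^\infty$-smoothly bounded planar domain is a bounded, nonempty, connected open set $\Omega\subset\mathbb{C}$ such that for each boundary point $p$ there are a neighbourhood $U$ of $p$ and a $C^\infty$ function $\rho:\mathbb{C}\to\mathbb{R}$ with $d\rho(p)\neq 0$ and $\Omega\cap U=\{z\in U:\rho(z)<0\}$. For such $\Omega$: - the Carathéodory metric is $c_\Omega(z)=\sup\{|f'(z)| : f:\Omega\to\mathbb{D}\text{ holomorphic},\ f(z)=0\}$, where $\mathbb{D}$ is the open unit disc; - $H^2(b\Omega)$ is the closure, in $L^2$ of the boundary $b\Omega$ with respect to arc length, of the boundary traces of the functions holomorphic on $\Omega$ and $C^\infty$-smooth on $\overline\Omega$; its elements are identified with their holomorphic extensions to $\Omega$, $S_\Omega(z,\zeta)$ (the Szegő kernel) is its reproducing kernel, $S_\Omega(z)=S_\Omega(z,z)$, and the Szegő metric is $s_\Omega(z)=\sqrt{\partial^2\log S_\Omega(z)/\partial z\,\partial\bar z}$; - the Gaussian curvature of a $C^2$-smooth conformal metric $m(z)|dz|$, $m>0$, is $\kappa_m(z)=-\Delta\log m(z)/m(z)^2$. Theorem. There is no real number $M$ such that $\kappa_{c_\Omega}(z)\ge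 M$ for all $C^\infty$-smoothly bounded planar domains $\Omega$ and all $z\in\Omega$, and there is no real number $M$ such that $\kappa_{s_\Omega}(z)\ge M$ for all such $\Omega$ and $z$. This is witnessed by the annuli $A_r=\{z\in\mathbb{C}: r<|z|<1\}$, $0<r<1$: each $A_r$ is a $C^\infty$-smoothly bounded domain on which $c_{A_r}(z)|dz|$ and $s_{A_r}(z)|dz|$ are $C^2$-smooth conformal metrics, and, as $r\to0^+$, $$\kappa_{c_{A_r}}(r^{1/2})\to-\infty\qquad\text{and}\qquad\kappa_{s_{A_r}}(r^{1/4})\to-\infty .$$ -/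

import Mathlib

open Set Filter Topology MeasureTheory
open scoped ContDiff ENNReal

noncomputable section

/-- A `C^∞`-smoothly bounded planar domain: a bounded, nonempty, connected open set which near each
of its boundary points `p` is the sublevel set `{ρ < 0}` of a smooth real function `ρ` with
nonvanishing differential at `p`. -/
structure IsSmoothlyBoundedDomain (Ω : Set ℂ) : Prop where
  isOpen : IsOpen Ω
  isConnected : IsConnected Ω
  isBounded : Bornology.IsBounded Ω
  smooth_boundary : ∀ p ∈ frontier Ω, ∃ ρ : ℂ → ℝ, ContDiff ℝ ∞ ρ ∧ fderiv ℝ ρ p ≠ 0 ∧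
    ∀ᶠ z in 𝓝 p, (z ∈ Ω ↔ ρ z < 0)

/-- The annulus `A_r = {z : r < |z| < 1}`. -/
def annulus (r : ℝ) : Set ℂ := {z : ℂ | r < ‖z‖ ∧ ‖z‖ < 1}

/-! ### Conformal metrics and their curvature -/

/-- The density `m` defines a conformal metric `m(z)|dz|` of class `C²` on `Ω`. -/
structure IsConformalMetricOn (m : ℂ → ℝ) (Ω : Set ℂ) : Prop where
  contDiffOn : ContDiffOn ℝ 2 m Ω
  pos : ∀ z ∈ Ω, 0 < m z

/-- The Gaussian curvature `κ_m = -Δ(log m)/m²` of the conformal metric `m(z)|dz|`. -/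
def gaussianCurvature (m : ℂ → ℝ) (z : ℂ) : ℝ :=
  -(Laplacian.laplacian (fun w : ℂ => Real.log (m w)) z) / m z ^ 2

/-- The Wirtinger derivative `∂/∂z = (∂/∂x - i ∂/∂y)/2`. -/
def wirtingerDz (u : ℂ → ℂ) (z : ℂ) : ℂ :=
  (fderiv ℝ u z 1 - Complex.I * fderiv ℝ u z Complex.I) / 2

/-- The Wirtinger derivative `∂/∂z̄ = (∂/∂x + i ∂/∂y)/2`. -/
def wirtingerDzBar (u : ℂ → ℂ) (z : ℂ) : ℂ :=
  (fderiv ℝ u z 1 + Complex.I * fderiv ℝ u z Complex.I) / 2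

/-! ### The Carathéodory metric -/

/-- The Carathéodory metric: the supremum of `|f'(z)|` over all holomorphic `f : Ω → 𝔻` with
`f z = 0`. -/
def caratheodoryMetric (Ω : Set ℂ) (z : ℂ) : ℝ :=
  sSup {t : ℝ | ∃ f : ℂ → ℂ, DifferentiableOn ℂ f Ω ∧ MapsTo f Ω (Metric.ball 0 1) ∧
    f z = 0 ∧ t = ‖deriv f z‖}

/-! ### The Szegő kernel and the Szegő metric -/

/-- The arc length measure `ds` on the boundary of `Ω`. -/
def arcLength (Ω : Set ℂ) : Measure ℂ :=
  (Measure.hausdorffMeasure 1).restrict (frontier Ω)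

/-- `f` is holomorphic on `Ω` and smooth on the closure of `Ω`. -/
def IsSmoothHolomorphic (Ω : Set ℂ) (f : ℂ → ℂ) : Prop :=
  DifferentiableOn ℂ f Ω ∧ ContDiffOn ℝ ∞ f (closure Ω)

/-- The boundary traces, in `L²(bΩ)`, of the holomorphic functions on `Ω` that are smooth on the
closure of `Ω`. -/
def smoothTraces (Ω : Set ℂ) : Submodule ℂ (Lp ℂ 2 (arcLength Ω)) where
  carrier := {g | ∃ f : ℂ → ℂ, IsSmoothHolomorphic Ω f ∧ g =ᵐ[arcLength Ω] f}
  add_mem' := by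
    rintro g h ⟨f, hf, hgf⟩ ⟨k, hk, hhk⟩
    refine ⟨f + k, ⟨hf.1.add hk.1, hf.2.add hk.2⟩, ?_⟩
    exact (Lp.coeFn_add g h).trans (hgf.add hhk)
  zero_mem' := ⟨0, ⟨differentiableOn_const 0, contDiffOn_const⟩, Lp.coeFn_zero _ _ _⟩
  smul_mem' := by
    rintro c g ⟨f, hf, hgf⟩
    refine ⟨c • f, ⟨hf.1.const_smul c, hf.2.const_smul c⟩, ?_⟩
    exact (Lp.coeFn_smul c g).trans (hgf.const_smul c)

/-- The Hardy space `H²(bΩ)`, the closure of the smooth traces in `L²(bΩ)`. -/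
def hardySpace (Ω : Set ℂ) : Submodule ℂ (Lp ℂ 2 (arcLength Ω)) :=
  (smoothTraces Ω).topologicalClosure

/-- `k ∈ H²(bΩ)` represents evaluation at `z`: one has `⟪k, f⟫ = f z` for all `f` holomorphic on `Ω`
and smooth on the closure. Such traces are dense in `H²(bΩ)`, so for every `h ∈ H²(bΩ)` the number
`⟪k, h⟫` is the value at `z` of the holomorphic extension of `h`. -/
def RepresentsEvaluation (Ω : Set ℂ) (z : ℂ) (k : Lp ℂ 2 (arcLength Ω)) : Prop :=
  k ∈ hardySpace Ω ∧ ∀ (f : ℂ → ℂ) (g : Lp ℂ 2 (arcLength Ω)), IsSmoothHolomorphic Ω f →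
    g =ᵐ[arcLength Ω] f → inner ℂ k g = f z

/-- There is at most one element representing evaluation at a point. -/
theorem RepresentsEvaluation.unique {Ω : Set ℂ} {z : ℂ} {k l : Lp ℂ 2 (arcLength Ω)}
    (hk : RepresentsEvaluation Ω z k) (hl : RepresentsEvaluation Ω z l) : k = l := by
  have horth : k - l ∈ (smoothTraces Ω)ᗮ := by
    rw [Submodule.mem_orthogonal']
    rintro g ⟨f, hf, hgf⟩
    rw [inner_sub_left, hk.2 f g hf hgf, hl.2 f g hf hgf, sub_self]
  rw [← Submodule.orthogonal_closure, Submodule.mem_orthogonal] at horth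
  have h0 := horth _ ((hardySpace Ω).sub_mem hk.1 hl.1)
  exact sub_eq_zero.mp (inner_self_eq_zero.mp h0)

open Classical in
/-- The element `k_ζ = S_Ω(·, ζ)` of `H²(bΩ)` representing evaluation at `ζ ∈ Ω`
(zero if there is none). -/
def szegoRepresenter (Ω : Set ℂ) (ζ : ℂ) : Lp ℂ 2 (arcLength Ω) :=
  if h : ∃ k, RepresentsEvaluation Ω ζ k then h.choose else 0

/-- The Szegő kernel `S_Ω(z, ζ)`, the reproducing kernel of `H²(bΩ)`: the value at `z` of the
holomorphic extension of `k_ζ`, which is `⟪k_z, k_ζ⟫`. -/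
def szegoKernel (Ω : Set ℂ) (z ζ : ℂ) : ℂ :=
  inner ℂ (szegoRepresenter Ω z) (szegoRepresenter Ω ζ)

/-- The Szegő kernel on the diagonal, `S_Ω(z) = S_Ω(z, z)`, a real number. -/
def szegoDiagonal (Ω : Set ℂ) (z : ℂ) : ℝ := (szegoKernel Ω z z).re

/-- The Szegő metric `s_Ω = √(∂²(log S_Ω)/∂z∂z̄)`. -/
def szegoMetric (Ω : Set ℂ) (z : ℂ) : ℝ :=
  √(wirtingerDz (wirtingerDzBar fun w => (Real.log (szegoDiagonal Ω w) : ℂ)) z).re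

end

/-! ### Geometry of annuli -/

/-! On `annulus r` the powers `z ^ n`, `n : ℤ`, are orthogonal in `L²` of the boundary, with squared
norm `L * (1 + r ^ (2 * n + 1))`, where `L` is the length of the unit circle. Hence `L * S(z) = ∑
w_n` with weights `w_n = exp (2 * n * u) / (1 + r ^ (2 * n + 1))` and `u = log ‖z‖`
(`szegoDiagonal_annulus`). The Carathéodory metric equals this same sum
(`caratheodoryMetric_annulus`). This is Garabedian's duality: the Szegő kernel is also a quotient of
infinite products, and on the boundary its conjugate is a Cauchy kernel times a nonvanishing
holomorphic factor. Dividing one by the other gives an extremal function, and Cauchy's formula gives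
the matching upper bound.

The sum of the weights is a partition function in `u`, so the derivatives of its logarithm are, up
to powers of 2, the cumulants of the normalized weights. With total mass `M`, variance `V` and
higher cumulants `K₃`, `K₄`, the metrics and curvatures are `c = M`, `s² = V / ‖z‖²`, `κ_c = -4 V /
(‖z‖² M²)` and `κ_s = -2 (K₄ / V - (K₃ / V)²) / V`.

It remains to see where the mass sits. For `r = s²`, `‖z‖ = s`, the weights tend to 1 at `n = 0` and
`n = -1` and to 0 elsewhere: a fair coin, so `M → 2`, `V → 1/4` and `κ_c ~ -1 / (4 s²)`. For `r =
s⁴`, `‖z‖ = s`, the mass at 0 tends to 1 while `n = 1` and `n = -1` each carry about `s²`. Then `V ~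
2 s²`, `K₄ ~ 2 s²`, `K₃ = o(s²)` and `κ_s ~ -1 / s²`. -/

theorem isOpen_annulus (r : ℝ) : IsOpen (annulus r) :=
  (isOpen_lt continuous_const continuous_norm).inter (isOpen_lt continuous_norm continuous_const)

theorem closure_annulus {r : ℝ} (h0 : 0 < r) (h1 : r < 1) :
    closure (annulus r) = {z : ℂ | r ≤ ‖z‖ ∧ ‖z‖ ≤ 1} := by
  apply Subset.antisymm
  · apply closure_minimal
    · exact fun z hz => ⟨hz.1.le, hz.2.le⟩
    · exact (isClosed_le continuous_const continuous_norm).inter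
        (isClosed_le continuous_norm continuous_const)
  · rintro z ⟨hz1, hz2⟩
    have hz0 : 0 < ‖z‖ := h0.trans_le hz1
    have hz : z ≠ 0 := norm_pos_iff.mp hz0
    -- A boundary point is approached along its own ray, by changing only the modulus `s`.
    have hcont : Continuous fun s : ℝ => ((s / ‖z‖ : ℝ) : ℂ) * z := by fun_prop
    have hmem : ‖z‖ ∈ closure (Ioo r 1) := by
      rw [closure_Ioo h1.ne]; exact ⟨hz1, hz2⟩
    have := map_mem_closure hcont hmem (t := annulus r) (by
      intro s hs
      have hs0 : 0 < s := h0.trans hs.1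
      have : ‖((s / ‖z‖ : ℝ) : ℂ) * z‖ = s := by
        rw [norm_mul, Complex.norm_real, Real.norm_of_nonneg (by positivity)]
        field_simp
      change r < _ ∧ _ < 1
      rw [this]
      exact hs)
    simpa [hz0.ne'] using this

theorem frontier_annulus {r : ℝ} (h0 : 0 < r) (h1 : r < 1) :
    frontier (annulus r) = Metric.sphere 0 1 ∪ Metric.sphere 0 r := by
  rw [(isOpen_annulus r).frontier_eq, closure_annulus h0 h1]
  ext z
  simp only [annulus, Set.mem_sdiff, mem_ofPred_eq, mem_union, mem_sphere_iff_norm, sub_zero, not_and,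
    not_lt]
  constructor
  · rintro ⟨⟨ha, hb⟩, hc⟩
    rcases ha.eq_or_lt with h | h
    · exact Or.inr h.symm
    · exact Or.inl (le_antisymm hb (hc h))
  · rintro (h | h)
    · exact ⟨⟨by linarith, h.le⟩, fun _ => h.ge⟩
    · exact ⟨⟨h.ge, by linarith⟩, fun h' => absurd h' (by linarith)⟩

theorem isConnected_annulus {r : ℝ} (h0 : 0 < r) (h1 : r < 1) : IsConnected (annulus r) := by
  have himg : annulus r = (fun p : ℝ × ℝ => circleMap 0 p.1 p.2) '' (Ioo r 1 ×ˢ univ) := by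
    ext z
    constructor
    · rintro ⟨ha, hb⟩
      refine ⟨(‖z‖, z.arg), ⟨⟨ha, hb⟩, mem_univ _⟩, ?_⟩
      simp [circleMap]
    · rintro ⟨p, ⟨hp, -⟩, rfl⟩
      have : ‖circleMap 0 p.1 p.2‖ = p.1 := by
        rw [norm_circleMap_zero, abs_of_pos (h0.trans hp.1)]
      change r < _ ∧ _ < 1
      rw [this]; exact hp
  rw [himg]
  refine ((isConnected_Ioo h1).prod isConnected_univ).image _ ?_
  have : Continuous fun p : ℝ × ℝ => circleMap 0 p.1 p.2 := by
    unfold circleMap; fun_prop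
  exact this.continuousOn

theorem annulus_isSmoothlyBounded {r : ℝ} (h0 : 0 < r) (h1 : r < 1) :
    IsSmoothlyBoundedDomain (annulus r) := by
  refine ⟨isOpen_annulus r, isConnected_annulus h0 h1, ?_, ?_⟩
  · exact Metric.isBounded_ball.subset (fun z hz => by simpa using hz.2 : annulus r ⊆ Metric.ball 0 1)
  · intro p hp
    rw [frontier_annulus h0 h1] at hp
    have hd : ∀ p : ℂ, HasFDerivAt (fun z : ℂ => ‖z‖ ^ 2) (2 • innerSL ℝ p) p := fun p =>
      (hasStrictFDerivAt_norm_sq p).hasFDerivAt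
    have hne : ∀ p : ℂ, p ≠ 0 → (2 • innerSL ℝ p : ℂ →L[ℝ] ℝ) ≠ 0 := by
      intro p hp h
      have := congrArg (fun L : ℂ →L[ℝ] ℝ => L p) h
      simp at this
      exact hp this
    rcases hp with hp | hp
    · have hp : ‖p‖ = 1 := by simpa using hp
      refine ⟨fun z => ‖z‖ ^ 2 - 1, (contDiff_norm_sq ℝ).sub contDiff_const, ?_, ?_⟩
      · rw [((hd p).sub_const 1).fderiv]
        exact hne p (norm_pos_iff.mp (by linarith))
      · filter_upwards [continuous_norm.continuousAt.eventually_const_lt (show r < ‖p‖ by rw [hp]; exact h1)]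
          with z hz
        constructor
        · intro h; have := h.2; nlinarith [norm_nonneg z]
        · intro h; exact ⟨hz, by nlinarith [norm_nonneg z]⟩
    · have hp : ‖p‖ = r := by simpa using hp
      refine ⟨fun z => r ^ 2 - ‖z‖ ^ 2, contDiff_const.sub (contDiff_norm_sq ℝ), ?_, ?_⟩
      · rw [((hd p).const_sub _).fderiv]
        exact neg_ne_zero.mpr (hne p (norm_pos_iff.mp (by linarith)))
      · filter_upwards [continuous_norm.continuousAt.eventually_lt_const (show ‖p‖ < 1 by rw [hp]; exact h1)]
          with z hz
        constructor
        · intro h; have := h.1; nlinarith [norm_nonneg z]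
        · intro h; exact ⟨by nlinarith [norm_nonneg z], hz⟩

/-! ### Calculus of radial functions in the plane -/

theorem hasFDerivAt_comp_log_norm {f : ℝ → ℝ} {c : ℝ} {z : ℂ} (hz : z ≠ 0)
    (hf : HasDerivAt f c (Real.log ‖z‖)) :
    HasFDerivAt (fun w : ℂ => f (Real.log ‖w‖)) ((c * (‖z‖ ^ 2)⁻¹) • innerSL ℝ z) z := by
  have hn : ‖z‖ ^ 2 ≠ 0 := pow_ne_zero _ (norm_ne_zero_iff.mpr hz)
  have h1 : HasFDerivAt (fun w : ℂ => ‖w‖ ^ 2) (2 • innerSL ℝ z) z :=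
    (hasStrictFDerivAt_norm_sq z).hasFDerivAt
  have h2 := ((h1.log hn).const_mul (1 / 2))
  have h3 : (fun w : ℂ => 1 / 2 * Real.log (‖w‖ ^ 2)) = fun w => Real.log ‖w‖ := by
    funext w
    rw [Real.log_pow]; push_cast; ring
  rw [h3] at h2
  have e : (c * (‖z‖ ^ 2)⁻¹) • innerSL ℝ z = c • (1 / 2 : ℝ) • (‖z‖ ^ 2)⁻¹ • 2 • innerSL ℝ z := by
    module
  rw [e]
  exact hf.comp_hasFDerivAt z h2

/-- The gradient of a function of `log ‖w‖` is a radial coefficient times `w`. Writing `‖w‖⁻²` as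
`exp (-2 * log ‖w‖)` makes the coefficient again a function of `log ‖w‖`, so that the first-order
lemma differentiates it a second time. -/
theorem hasFDerivAt_fderiv_comp_log_norm {φ φ' : ℝ → ℝ} {c : ℝ} {z : ℂ} (hz : z ≠ 0)
    (h1 : ∀ᶠ u in 𝓝 (Real.log ‖z‖), HasDerivAt φ (φ' u) u)
    (h2 : HasDerivAt φ' c (Real.log ‖z‖)) :
    (∀ᶠ w in 𝓝 z, HasFDerivAt (fun w : ℂ => φ (Real.log ‖w‖))
        ((φ' (Real.log ‖w‖) * Real.exp (-2 * Real.log ‖w‖)) • innerSL ℝ w) w) ∧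
      HasFDerivAt (fun w : ℂ => φ' (Real.log ‖w‖) * Real.exp (-2 * Real.log ‖w‖))
        (((c - 2 * φ' (Real.log ‖z‖)) * (‖z‖ ^ 2)⁻¹ ^ 2) • innerSL ℝ z) z := by
  have hexp : ∀ w : ℂ, w ≠ 0 → Real.exp (-2 * Real.log ‖w‖) = (‖w‖ ^ 2)⁻¹ := by
    intro w hw
    have : -2 * Real.log ‖w‖ = Real.log ((‖w‖ ^ 2)⁻¹) := by
      rw [Real.log_inv, Real.log_pow]; push_cast; ring
    rw [this, Real.exp_log (by positivity)]
  constructor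
  · have hc : ContinuousAt (fun w : ℂ => Real.log ‖w‖) z :=
      continuous_norm.continuousAt.log (norm_ne_zero_iff.mpr hz)
    filter_upwards [hc.eventually h1, isOpen_ne.mem_nhds hz] with w hw hw0
    rw [hexp w hw0]
    exact hasFDerivAt_comp_log_norm hw0 hw
  · have h3 : HasDerivAt (fun u => φ' u * Real.exp (-2 * u))
        ((c - 2 * φ' (Real.log ‖z‖)) * Real.exp (-2 * Real.log ‖z‖)) (Real.log ‖z‖) := by
      have := h2.mul (((hasDerivAt_id (Real.log ‖z‖)).const_mul (-2)).exp)
      refine this.congr_deriv ?_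
      simp only [id_eq]; ring
    have := hasFDerivAt_comp_log_norm hz h3
    rw [hexp z hz] at this
    convert this using 2
    ring

/-- Since `log ‖z‖` is harmonic with gradient of length `1 / ‖z‖`, only the second derivative of the
profile survives. -/
theorem laplacian_comp_log_norm {F : ℂ → ℝ} {φ φ' : ℝ → ℝ} {c : ℝ} {z : ℂ} (hz : z ≠ 0)
    (hF : F =ᶠ[𝓝 z] fun w => φ (Real.log ‖w‖))
    (h1 : ∀ᶠ u in 𝓝 (Real.log ‖z‖), HasDerivAt φ (φ' u) u)
    (h2 : HasDerivAt φ' c (Real.log ‖z‖)) :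
    Laplacian.laplacian F z = c / ‖z‖ ^ 2 := by
  obtain ⟨h3, h4⟩ := hasFDerivAt_fderiv_comp_log_norm hz h1 h2
  have hD : fderiv ℝ F =ᶠ[𝓝 z] fun w : ℂ =>
      (φ' (Real.log ‖w‖) * Real.exp (-2 * Real.log ‖w‖)) • innerSL ℝ w := by
    filter_upwards [h3, hF.eventuallyEq_nhds] with w hw hw'
    rw [hw'.fderiv_eq, hw.fderiv]
  have h5 : HasFDerivAt (fun w : ℂ =>
      (φ' (Real.log ‖w‖) * Real.exp (-2 * Real.log ‖w‖)) • innerSL ℝ w) _ z :=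
    h4.smul (innerSL ℝ : ℂ →L[ℝ] ℂ →L[ℝ] ℝ).hasFDerivAt
  have hn : ‖z‖ ^ 2 ≠ 0 := pow_ne_zero _ (norm_ne_zero_iff.mpr hz)
  have hexp : Real.exp (-2 * Real.log ‖z‖) = (‖z‖ ^ 2)⁻¹ := by
    have : -2 * Real.log ‖z‖ = Real.log ((‖z‖ ^ 2)⁻¹) := by
      rw [Real.log_inv, Real.log_pow]; push_cast; ring
    rw [this, Real.exp_log (by positivity)]
  rw [InnerProductSpace.laplacian_eq_iteratedFDeriv_complexPlane]
  simp only [iteratedFDeriv_two_apply]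
  rw [hD.fderiv_eq, HasFDerivAt.fderiv h5]
  simp only [hexp]
  have hsq : ‖z‖ ^ 2 = z.re ^ 2 + z.im ^ 2 := by
    rw [Complex.sq_norm, Complex.normSq_apply]; ring
  have hi : ∀ a b : ℂ, inner ℝ a b = a.re * b.re + a.im * b.im := by
    intro a b
    rw [Complex.inner]; simp; ring
  have hi' : ∀ a b : ℂ, innerSL ℝ a b = a.re * b.re + a.im * b.im := hi
  simp [hi']
  rw [hsq] at hn ⊢
  field_simp
  ring

theorem wirtinger_comp_log_norm {F : ℂ → ℝ} {φ φ' : ℝ → ℝ} {c : ℝ} {z : ℂ} (hz : z ≠ 0)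
    (hF : F =ᶠ[𝓝 z] fun w => φ (Real.log ‖w‖))
    (h1 : ∀ᶠ u in 𝓝 (Real.log ‖z‖), HasDerivAt φ (φ' u) u)
    (h2 : HasDerivAt φ' c (Real.log ‖z‖)) :
    (wirtingerDz (wirtingerDzBar fun w => (F w : ℂ)) z).re = c / (4 * ‖z‖ ^ 2) := by
  obtain ⟨h3, h4⟩ := hasFDerivAt_fderiv_comp_log_norm hz h1 h2
  have hi : ∀ a b : ℂ, inner ℝ a b = a.re * b.re + a.im * b.im := by
    intro a b
    rw [Complex.inner]; simp; ring
  have hD : wirtingerDzBar (fun w => (F w : ℂ)) =ᶠ[𝓝 z] fun w : ℂ =>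
      (φ' (Real.log ‖w‖) * Real.exp (-2 * Real.log ‖w‖)) • (w / 2) := by
    filter_upwards [h3, hF.eventuallyEq_nhds] with w hw hw'
    have hw2 : HasFDerivAt F _ w := hw.congr_of_eventuallyEq hw'
    have := (Complex.ofRealCLM.hasFDerivAt.comp w hw2)
    have h' : fderiv ℝ (fun w => (F w : ℂ)) w = _ := HasFDerivAt.fderiv this
    rw [wirtingerDzBar, h']
    apply Complex.ext <;> simp [hi] <;> ring
  have h5 := h4.smul ((hasFDerivAt_id (𝕜 := ℝ) z).mul_const (2 : ℂ)⁻¹)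
  have hn : ‖z‖ ^ 2 ≠ 0 := pow_ne_zero _ (norm_ne_zero_iff.mpr hz)
  have hexp : Real.exp (-2 * Real.log ‖z‖) = (‖z‖ ^ 2)⁻¹ := by
    have : -2 * Real.log ‖z‖ = Real.log ((‖z‖ ^ 2)⁻¹) := by
      rw [Real.log_inv, Real.log_pow]; push_cast; ring
    rw [this, Real.exp_log (by positivity)]
  have hsq : ‖z‖ ^ 2 = z.re ^ 2 + z.im ^ 2 := by
    rw [Complex.sq_norm, Complex.normSq_apply]; ring
  have h6 : fderiv ℝ (wirtingerDzBar fun w => (F w : ℂ)) z = _ :=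
    hD.fderiv_eq.trans (HasFDerivAt.fderiv h5)
  have hs : (‖z‖ ^ 2)⁻¹ * (z.re ^ 2 + z.im ^ 2) = 1 := by rw [← hsq]; exact inv_mul_cancel₀ hn
  have hr : c / (4 * ‖z‖ ^ 2) = c * (‖z‖ ^ 2)⁻¹ / 4 := by field_simp
  rw [wirtingerDz, h6, hexp, hr]
  generalize (‖z‖ ^ 2)⁻¹ = s at *
  simp [hi, -Complex.ofReal_pow]
  linear_combination (c - 2 * φ' (Real.log ‖z‖)) * s / 4 * hs

theorem contDiffOn_comp_log_norm {φ : ℝ → ℝ} {r : ℝ} (h0 : 0 < r) {n : ℕ∞}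
    (h : ContDiffOn ℝ n φ (Ioo (Real.log r) 0)) :
    ContDiffOn ℝ n (fun z : ℂ => φ (Real.log ‖z‖)) (annulus r) := by
  have hne : ∀ z ∈ annulus r, z ≠ 0 := fun z hz => norm_pos_iff.mp (h0.trans hz.1)
  refine h.comp (t := Ioo (Real.log r) 0) ?_ ?_
  · intro z hz
    exact ((contDiffAt_norm ℝ (hne z hz)).log (norm_ne_zero_iff.mpr (hne z hz))).contDiffWithinAt
  · intro z hz
    exact ⟨Real.log_lt_log h0 hz.1, Real.log_neg (h0.trans hz.1) hz.2⟩

/-! ### Moments of the weights of the Szegő kernel -/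

/-- The `n`-th term of the diagonal Szegő kernel of the annulus at a point of modulus `exp u`. -/
noncomputable def szegoTerm (r : ℝ) (u : ℝ) (n : ℤ) : ℝ :=
  (1 + r ^ (2 * n + 1))⁻¹ * Real.exp (2 * n * u)

/-- The `k`-th moment of the weights `szegoTerm r u`. -/
noncomputable def szegoMoment (r : ℝ) (k : ℕ) (u : ℝ) : ℝ := ∑' n : ℤ, (n : ℝ) ^ k * szegoTerm r u n

theorem szegoTerm_pos {r : ℝ} (h0 : 0 < r) (u : ℝ) (n : ℤ) : 0 < szegoTerm r u n := by
  unfold szegoTerm; positivity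

theorem szegoTerm_natCast_le {r : ℝ} (h0 : 0 < r) (u : ℝ) (n : ℕ) :
    szegoTerm r u n ≤ Real.exp (2 * u) ^ n := by
  unfold szegoTerm
  rw [← Real.exp_nat_mul]
  have h1 : (1 + r ^ (2 * (n : ℤ) + 1))⁻¹ ≤ 1 := inv_le_one_of_one_le₀ (by
    have : 0 < r ^ (2 * (n : ℤ) + 1) := by positivity
    linarith)
  calc _ ≤ 1 * Real.exp (2 * ((n : ℤ) : ℝ) * u) := by gcongr
    _ = _ := by rw [one_mul]; congr 1; push_cast; ring

theorem szegoTerm_neg_natCast_le {r : ℝ} (h0 : 0 < r) (u : ℝ) (n : ℕ) :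
    szegoTerm r u (-(n : ℤ)) ≤ r⁻¹ * (r ^ 2 * Real.exp (-2 * u)) ^ n := by
  unfold szegoTerm
  have hp : 0 < r ^ (2 * (-(n : ℤ)) + 1) := by positivity
  have h1 : (1 + r ^ (2 * (-(n : ℤ)) + 1))⁻¹ ≤ (r ^ (2 * (-(n : ℤ)) + 1))⁻¹ :=
    inv_anti₀ hp (by linarith)
  have h2 : (r ^ (2 * (-(n : ℤ)) + 1))⁻¹ = r⁻¹ * (r ^ 2) ^ n := by
    rw [zpow_add₀ h0.ne', zpow_mul, zpow_neg]
    simp [mul_comm]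
  have h3 : Real.exp (2 * ((-(n : ℤ) : ℤ) : ℝ) * u) = Real.exp (-2 * u) ^ n := by
    rw [← Real.exp_nat_mul]; congr 1; push_cast; ring
  calc _ ≤ (r⁻¹ * (r ^ 2) ^ n) * Real.exp (-2 * u) ^ n := by
        rw [h3, ← h2]; gcongr
    _ = _ := by rw [mul_pow]; ring

/-- Both tails are geometric up to the polynomial factor: with `‖z‖ = exp u` the ratio is `‖z‖²` for
positive `n` and `r² / ‖z‖²` for negative `n`, and both are below 1 inside the annulus. -/
theorem summable_szegoTerm {r u : ℝ} (h0 : 0 < r) (hu : u ∈ Ioo (Real.log r) 0) (k : ℕ) :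
    Summable fun n : ℤ => |(n : ℝ)| ^ k * szegoTerm r u n := by
  have hq1 : Real.exp (2 * u) < 1 := by rw [Real.exp_lt_one_iff]; linarith [hu.2]
  have hq2 : r ^ 2 * Real.exp (-2 * u) < 1 := by
    have : r ^ 2 = Real.exp (2 * Real.log r) := by
      rw [two_mul, Real.exp_add, Real.exp_log h0, sq]
    rw [this, ← Real.exp_add, Real.exp_lt_one_iff]; linarith [hu.1]
  apply Summable.of_nat_of_neg
  · refine Summable.of_nonneg_of_le (fun n => ?_) (fun n => ?_)
      (summable_pow_mul_geometric_of_norm_lt_one k (r := Real.exp (2 * u))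
        (by rwa [Real.norm_of_nonneg (Real.exp_pos _).le]))
    · have := szegoTerm_pos h0 u n; positivity
    · simp only [Int.cast_natCast, Nat.abs_cast]
      gcongr
      exact szegoTerm_natCast_le h0 u n
  · refine Summable.of_nonneg_of_le (fun n => ?_) (fun n => ?_)
      ((summable_pow_mul_geometric_of_norm_lt_one k (r := r ^ 2 * Real.exp (-2 * u))
        (by rwa [Real.norm_of_nonneg (by positivity)])).mul_left r⁻¹)
    · have := szegoTerm_pos h0 u (-n); positivity
    · simp only [Int.cast_neg, Int.cast_natCast, abs_neg, Nat.abs_cast]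
      calc _ ≤ (n : ℝ) ^ k * (r⁻¹ * (r ^ 2 * Real.exp (-2 * u)) ^ n) := by
            gcongr; exact szegoTerm_neg_natCast_le h0 u n
        _ = _ := by ring

theorem summable_szegoMoment {r u : ℝ} (h0 : 0 < r) (hu : u ∈ Ioo (Real.log r) 0) (k : ℕ) :
    Summable fun n : ℤ => (n : ℝ) ^ k * szegoTerm r u n := by
  refine Summable.of_norm_bounded (summable_szegoTerm h0 hu k) fun n => ?_
  rw [norm_mul, norm_pow, Real.norm_eq_abs, Real.norm_of_nonneg (szegoTerm_pos h0 u n).le]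

/-- Differentiation in `u` multiplies the `n`-th weight by `2 * n`, which raises the order of the
moment. Termwise differentiation is justified on an interval around `u` by the endpoint bound `exp
(2 * n * y) ≤ exp (2 * n * α) + exp (2 * n * β)`. -/
theorem hasDerivAt_szegoMoment {r u : ℝ} (h0 : 0 < r) (hu : u ∈ Ioo (Real.log r) 0) (k : ℕ) :
    HasDerivAt (szegoMoment r k) (2 * szegoMoment r (k + 1) u) u := by
  obtain ⟨α, hα1, hα2⟩ := exists_between hu.1
  obtain ⟨β, hβ1, hβ2⟩ := exists_between hu.2
  have hα : α ∈ Ioo (Real.log r) 0 := ⟨hα1, hα2.trans hu.2⟩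
  have hβ : β ∈ Ioo (Real.log r) 0 := ⟨hu.1.trans hβ1, hβ2⟩
  have hsum := ((summable_szegoTerm h0 hα (k + 1)).add (summable_szegoTerm h0 hβ (k + 1))).mul_left 2
  have hder : ∀ (n : ℤ) (y : ℝ), y ∈ Ioo α β →
      HasDerivAt (fun y => (n : ℝ) ^ k * szegoTerm r y n) (2 * ((n : ℝ) ^ (k + 1) * szegoTerm r y n))
        y := by
    intro n y _
    have := (((((hasDerivAt_id y).const_mul (2 * (n : ℝ))).exp).const_mul
      (1 + r ^ (2 * n + 1))⁻¹)).const_mul ((n : ℝ) ^ k)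
    refine this.congr_deriv ?_
    simp only [id_eq, szegoTerm]; ring
  have hbd : ∀ (n : ℤ) (y : ℝ), y ∈ Ioo α β → ‖2 * ((n : ℝ) ^ (k + 1) * szegoTerm r y n)‖ ≤
      2 * (|(n : ℝ)| ^ (k + 1) * szegoTerm r α n + |(n : ℝ)| ^ (k + 1) * szegoTerm r β n) := by
    intro n y hy
    rw [norm_mul, norm_mul, norm_pow, Real.norm_eq_abs (n : ℝ),
      Real.norm_of_nonneg (szegoTerm_pos h0 y n).le, ← mul_add, Real.norm_of_nonneg zero_le_two]
    gcongr
    unfold szegoTerm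
    rw [← mul_add]
    gcongr
    -- The exponential is monotone in `y`, so it is at most its value at `β` or at `α`, according to
    -- the sign of `n`.
    rcases le_total 0 (n : ℝ) with hn | hn
    · have : Real.exp (2 * n * y) ≤ Real.exp (2 * n * β) := Real.exp_le_exp.mpr (by
        gcongr; exact hy.2.le)
      linarith [Real.exp_pos (2 * n * α)]
    · have : Real.exp (2 * n * y) ≤ Real.exp (2 * n * α) := Real.exp_le_exp.mpr (by
        nlinarith [hy.1])
      linarith [Real.exp_pos (2 * n * β)]
  have := hasDerivAt_tsum_of_isPreconnected hsum isOpen_Ioo isPreconnected_Ioo hder hbd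
    (y₀ := u) ⟨hα2, hβ1⟩ (summable_szegoMoment h0 hu k) ⟨hα2, hβ1⟩
  rw [tsum_mul_left] at this
  exact this

theorem contDiffOn_szegoMoment {r : ℝ} (h0 : 0 < r) (n k : ℕ) :
    ContDiffOn ℝ n (szegoMoment r k) (Ioo (Real.log r) 0) := by
  induction n generalizing k with
  | zero =>
    exact contDiffOn_zero.mpr fun u hu =>
      (hasDerivAt_szegoMoment h0 hu k).continuousAt.continuousWithinAt
  | succ n ih =>
    have : ((n + 1 : ℕ) : WithTop ℕ∞) = (n : WithTop ℕ∞) + 1 := by push_cast; rfl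
    rw [this, contDiffOn_succ_iff_deriv_of_isOpen isOpen_Ioo]
    refine ⟨fun u hu => (hasDerivAt_szegoMoment h0 hu k).differentiableAt.differentiableWithinAt,
      by simp, ?_⟩
    exact (contDiffOn_const.mul (ih (k + 1))).congr fun u hu => (hasDerivAt_szegoMoment h0 hu k).deriv

theorem szegoMoment_zero_pos {r u : ℝ} (h0 : 0 < r) (hu : u ∈ Ioo (Real.log r) 0) :
    0 < szegoMoment r 0 u :=
  (summable_szegoMoment h0 hu 0).tsum_pos (fun n => by simpa using (szegoTerm_pos h0 u n).le) 0
    (by simpa using szegoTerm_pos h0 u 0)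

/-! ### Means, variance and cumulants of the normalized weights. -/

/-- The normalized moments. -/
noncomputable def szegoMean (r : ℝ) (k : ℕ) (u : ℝ) : ℝ := szegoMoment r k u / szegoMoment r 0 u

theorem hasDerivAt_szegoMean {r u : ℝ} (h0 : 0 < r) (hu : u ∈ Ioo (Real.log r) 0) (k : ℕ) :
    HasDerivAt (szegoMean r k)
      (2 * (szegoMean r (k + 1) u - szegoMean r k u * szegoMean r 1 u)) u := by
  have hp := (szegoMoment_zero_pos h0 hu).ne'
  refine ((hasDerivAt_szegoMoment h0 hu k).div (hasDerivAt_szegoMoment h0 hu 0) hp).congr_deriv ?_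
  unfold szegoMean
  field_simp

theorem contDiffOn_szegoMean {r : ℝ} (h0 : 0 < r) (n k : ℕ) :
    ContDiffOn ℝ n (szegoMean r k) (Ioo (Real.log r) 0) :=
  (contDiffOn_szegoMoment h0 n k).div (contDiffOn_szegoMoment h0 n 0) fun _ hu =>
    (szegoMoment_zero_pos h0 hu).ne'

/-- The variance of the normalized weights. -/
noncomputable def szegoVariance (r u : ℝ) : ℝ := szegoMean r 2 u - szegoMean r 1 u ^ 2

/-- The third cumulant of the normalized weights. -/
noncomputable def szegoCumulantThree (r u : ℝ) : ℝ :=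
  szegoMean r 3 u - 3 * szegoMean r 1 u * szegoMean r 2 u + 2 * szegoMean r 1 u ^ 3

/-- The fourth cumulant of the normalized weights. -/
noncomputable def szegoCumulantFour (r u : ℝ) : ℝ :=
  szegoMean r 4 u - 4 * szegoMean r 1 u * szegoMean r 3 u - 3 * szegoMean r 2 u ^ 2
    + 12 * szegoMean r 1 u ^ 2 * szegoMean r 2 u - 6 * szegoMean r 1 u ^ 4

/-- The variance times the total mass is the sum of `(n - μ) ^ 2` against positive weights. The mean
`μ` cannot equal both 0 and 1, so some term is positive. -/
theorem szegoVariance_pos {r u : ℝ} (h0 : 0 < r) (hu : u ∈ Ioo (Real.log r) 0) :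
    0 < szegoVariance r u := by
  have hp := szegoMoment_zero_pos h0 hu
  set μ := szegoMean r 1 u with hμ
  have hs0 := summable_szegoMoment h0 hu 0
  have hs1 := summable_szegoMoment h0 hu 1
  have hs2 := summable_szegoMoment h0 hu 2
  have hsum : HasSum (fun n : ℤ => ((n : ℝ) - μ) ^ 2 * szegoTerm r u n)
      (szegoMoment r 2 u - 2 * μ * szegoMoment r 1 u + μ ^ 2 * szegoMoment r 0 u) := by
    have := (hs2.hasSum.sub (hs1.hasSum.mul_left (2 * μ))).add (hs0.hasSum.mul_left (μ ^ 2))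
    refine this.congr_fun ?_
    intro n; ring
  have hnn : ∀ n : ℤ, 0 ≤ ((n : ℝ) - μ) ^ 2 * szegoTerm r u n := fun n =>
    mul_nonneg (sq_nonneg _) (szegoTerm_pos h0 u n).le
  have hpos : 0 < ∑' n : ℤ, ((n : ℝ) - μ) ^ 2 * szegoTerm r u n := by
    by_cases h : μ = 0
    · refine hsum.summable.tsum_pos hnn 1 ?_
      have := szegoTerm_pos h0 u 1
      rw [h]; simpa using this
    · refine hsum.summable.tsum_pos hnn 0 ?_
      have := szegoTerm_pos h0 u 0
      push_cast
      rw [zero_sub, neg_sq]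
      positivity
  rw [hsum.tsum_eq] at hpos
  have : szegoVariance r u =
      (szegoMoment r 2 u - 2 * μ * szegoMoment r 1 u + μ ^ 2 * szegoMoment r 0 u)
        / szegoMoment r 0 u := by
    rw [szegoVariance, ← hμ, hμ]; unfold szegoMean
    field_simp
    ring
  rw [this]
  positivity

theorem hasDerivAt_szegoVariance {r u : ℝ} (h0 : 0 < r) (hu : u ∈ Ioo (Real.log r) 0) :
    HasDerivAt (szegoVariance r) (2 * szegoCumulantThree r u) u := by
  refine ((hasDerivAt_szegoMean h0 hu 2).sub ((hasDerivAt_szegoMean h0 hu 1).pow 2)).congr_deriv ?_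
  unfold szegoCumulantThree; simp only [Nat.reduceAdd]; push_cast; ring

theorem hasDerivAt_szegoCumulantThree {r u : ℝ} (h0 : 0 < r) (hu : u ∈ Ioo (Real.log r) 0) :
    HasDerivAt (szegoCumulantThree r) (2 * szegoCumulantFour r u) u := by
  have h1 := hasDerivAt_szegoMean h0 hu 1
  have h2 := hasDerivAt_szegoMean h0 hu 2
  have h3 := hasDerivAt_szegoMean h0 hu 3
  refine ((h3.sub ((h1.const_mul 3).mul h2)).add ((h1.pow 3).const_mul 2)).congr_deriv ?_
  unfold szegoCumulantFour; simp only [Nat.reduceAdd]; push_cast; ring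

theorem contDiffOn_szegoVariance {r : ℝ} (h0 : 0 < r) (n : ℕ) :
    ContDiffOn ℝ n (szegoVariance r) (Ioo (Real.log r) 0) :=
  (contDiffOn_szegoMean h0 n 2).sub ((contDiffOn_szegoMean h0 n 1).pow 2)

theorem hasDerivAt_log_szegoMoment_zero {r u : ℝ} (h0 : 0 < r) (hu : u ∈ Ioo (Real.log r) 0) :
    HasDerivAt (fun u => Real.log (szegoMoment r 0 u)) (2 * szegoMean r 1 u) u := by
  refine ((hasDerivAt_szegoMoment h0 hu 0).log (szegoMoment_zero_pos h0 hu).ne').congr_deriv ?_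
  unfold szegoMean; ring

theorem hasDerivAt_two_mul_szegoMean_one {r u : ℝ} (h0 : 0 < r) (hu : u ∈ Ioo (Real.log r) 0) :
    HasDerivAt (fun u => 2 * szegoMean r 1 u) (4 * szegoVariance r u) u := by
  refine ((hasDerivAt_szegoMean h0 hu 1).const_mul 2).congr_deriv ?_
  unfold szegoVariance; simp only [Nat.reduceAdd]; ring

/-! ### Integration over circles with respect to arc length -/

/-- The length of the unit circle. -/
noncomputable def unitCircleLength : ℝ := (Measure.hausdorffMeasure 1 : Measure ℂ).real (Metric.sphere 0 1)

theorem hausdorffMeasure_sphere_lt_top (R : ℝ) :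
    (Measure.hausdorffMeasure 1 : Measure ℂ) (Metric.sphere 0 R) < ⊤ := by
  rcases lt_or_ge R 0 with hR | hR
  · simp [Metric.sphere_eq_empty_of_neg hR]
  have himg : circleMap 0 R '' Ioc 0 (2 * Real.pi) = Metric.sphere 0 R := by
    rw [image_circleMap_Ioc, abs_of_nonneg hR]
  rw [← himg]
  refine ((lipschitzWith_circleMap 0 R).hausdorffMeasure_image_le zero_le_one _).trans_lt ?_
  rw [hausdorffMeasure_real]
  simp [ENNReal.mul_lt_top]

open scoped Pointwise in
theorem hausdorffMeasure_real_sphere {R : ℝ} (hR : 0 < R) :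
    (Measure.hausdorffMeasure 1 : Measure ℂ).real (Metric.sphere 0 R) = R * unitCircleLength := by
  have h : (R : ℝ) • Metric.sphere (0 : ℂ) 1 = Metric.sphere 0 R := by
    rw [smul_sphere' hR.ne']; simp [abs_of_pos hR]
  rw [unitCircleLength, ← h, Measure.real, Measure.hausdorffMeasure_smul₀ zero_le_one hR.ne']
  simp [Measure.real, ENNReal.smul_def, abs_of_pos hR]

/-- The projection to the real axis is 1-Lipschitz and the image of the circle covers `Ioo 0 1`. The
exact length is never needed: it cancels from the Carathéodory metric and is an additive constant in
the logarithm defining the Szegő metric. -/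
theorem unitCircleLength_pos : 0 < unitCircleLength := by
  refine ENNReal.toReal_pos ?_ (hausdorffMeasure_sphere_lt_top 1).ne
  intro h
  have hl : LipschitzWith 1 Complex.re := LipschitzWith.of_dist_le_mul fun x y => by
    simpa [dist_eq_norm] using Complex.abs_re_le_norm (x - y)
  have h1 := hl.hausdorffMeasure_image_le (d := 1) zero_le_one (Metric.sphere 0 1)
  rw [h, hausdorffMeasure_real] at h1
  have h2 : Ioo (0 : ℝ) 1 ⊆ Complex.re '' Metric.sphere 0 1 := by
    intro x hx
    refine ⟨⟨x, √(1 - x ^ 2)⟩, ?_, rfl⟩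
    have : ‖(⟨x, √(1 - x ^ 2)⟩ : ℂ)‖ ^ 2 = 1 := by
      rw [Complex.sq_norm, Complex.normSq_mk, ← sq, ← sq, Real.sq_sqrt (by nlinarith [hx.1, hx.2])]
      ring
    rw [mem_sphere_zero_iff_norm]
    exact (pow_eq_one_iff_of_nonneg (norm_nonneg _) two_ne_zero).mp this
  have h3 := (measure_mono h2).trans h1
  simp at h3

theorem setIntegral_sphere_mul {R : ℝ} (F : ℂ → ℂ) (c : Circle) :
    ∫ z in Metric.sphere 0 R, F (c * z) ∂(Measure.hausdorffMeasure 1) =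
      ∫ z in Metric.sphere 0 R, F z ∂(Measure.hausdorffMeasure 1) := by
  let e : ℂ ≃ᵢ ℂ := (rotation c).toIsometryEquiv
  have h1 := (e.measurePreserving_hausdorffMeasure 1).setIntegral_preimage_emb
    e.toHomeomorph.measurableEmbedding F (Metric.sphere 0 R)
  have h2 : e ⁻¹' Metric.sphere 0 R = Metric.sphere 0 R := by
    ext z
    rw [mem_preimage, mem_sphere_zero_iff_norm, mem_sphere_zero_iff_norm]
    exact iff_of_eq (congrArg (· = R) ((rotation c).norm_map z))
  rw [h2] at h1
  exact h1

/-- Hausdorff measure on the circle is rotation invariant. Averaging the integral over all rotations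
leaves it unchanged, while by Fubini the inner integral becomes the circle average at every point.
No parametrization of the Hausdorff measure is required. -/
theorem setIntegral_sphere_eq {R : ℝ} (hR : 0 < R) {F : ℂ → ℂ}
    (hF : ContinuousOn F (Metric.sphere 0 R)) :
    ∫ z in Metric.sphere 0 R, F z ∂(Measure.hausdorffMeasure 1) =
      (R * unitCircleLength : ℝ) * Real.circleAverage F 0 R := by
  set ν : Measure ℂ := (Measure.hausdorffMeasure 1).restrict (Metric.sphere 0 R) with hν
  have : IsFiniteMeasure ν := ⟨by
    rw [hν, Measure.restrict_apply_univ]; exact hausdorffMeasure_sphere_lt_top R⟩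
  have hπ : (2 * Real.pi : ℝ) ≠ 0 := by positivity
  have hmaps : MapsTo (fun p : ℝ × ℂ => (Circle.exp p.1 : ℂ) * p.2)
      (uIcc 0 (2 * Real.pi) ×ˢ Metric.sphere 0 R) (Metric.sphere 0 R) := by
    rintro ⟨θ, z⟩ ⟨-, hz⟩
    simpa using hz
  have hcont : ContinuousOn (fun p : ℝ × ℂ => F ((Circle.exp p.1 : ℂ) * p.2))
      (uIcc 0 (2 * Real.pi) ×ˢ Metric.sphere 0 R) :=
    hF.comp (by fun_prop) hmaps
  have hint : Integrable (Function.uncurry fun (θ : ℝ) (z : ℂ) => F ((Circle.exp θ : ℂ) * z))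
      ((volume.restrict (uIoc 0 (2 * Real.pi))).prod ν) := by
    have h1 : ν = ν.restrict (Metric.sphere 0 R) := by
      rw [hν, Measure.restrict_restrict Metric.isClosed_sphere.measurableSet, inter_self]
    rw [h1, Measure.prod_restrict]
    exact (hcont.integrableOn_compact (isCompact_uIcc.prod (isCompact_sphere 0 R))).mono_set
      (prod_mono uIoc_subset_uIcc Subset.rfl)
  have hswap := intervalIntegral_integral_swap hint
  have hl : ∀ θ : ℝ, ∫ z, F ((Circle.exp θ : ℂ) * z) ∂ν = ∫ z, F z ∂ν := fun θ =>
    setIntegral_sphere_mul F (Circle.exp θ)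
  simp only [hl, intervalIntegral.integral_const, sub_zero] at hswap
  have hr : ∫ z, (∫ θ in (0 : ℝ)..(2 * Real.pi), F ((Circle.exp θ : ℂ) * z)) ∂ν =
      ∫ z, ((2 * Real.pi : ℝ) : ℂ) * Real.circleAverage F 0 R ∂ν := by
    refine setIntegral_congr_fun Metric.isClosed_sphere.measurableSet fun z hz => ?_
    have hz : ‖z‖ = R := by simpa using hz
    -- Rotating `z` through all angles traverses the circle from the phase `z.arg`, and by
    -- periodicity the starting phase does not affect the average.
    have : ∀ θ : ℝ, (Circle.exp θ : ℂ) * z = circleMap 0 R (θ + z.arg) := by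
      intro θ
      rw [circleMap, zero_add, Circle.coe_exp, ← hz]
      conv_lhs => rw [← Complex.norm_mul_exp_arg_mul_I z]
      push_cast
      rw [add_mul, Complex.exp_add]; ring
    simp only [this]
    rw [Real.circleAverage_eq_integral_add z.arg, Complex.real_smul]
    push_cast
    field_simp
  rw [hr, integral_const] at hswap
  have hreal : ν.real univ = R * unitCircleLength := by
    rw [← hausdorffMeasure_real_sphere hR, hν, measureReal_restrict_apply_univ]
  rw [hreal, Complex.real_smul, Complex.real_smul] at hswap
  have h2 : ((2 * Real.pi : ℝ) : ℂ) ≠ 0 := by exact_mod_cast hπ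
  apply mul_left_cancel₀ h2
  rw [hswap]; ring

theorem integral_arcLength_annulus {r : ℝ} (h0 : 0 < r) (h1 : r < 1) {F : ℂ → ℂ}
    (hF : ContinuousOn F (frontier (annulus r))) :
    ∫ z, F z ∂(arcLength (annulus r)) =
      unitCircleLength * (Real.circleAverage F 0 1 + r * Real.circleAverage F 0 r) := by
  rw [frontier_annulus h0 h1] at hF
  have hd : Disjoint (Metric.sphere (0 : ℂ) 1) (Metric.sphere 0 r) := by
    rw [Set.disjoint_left]
    intro z hz hz'
    rw [mem_sphere_zero_iff_norm] at hz hz'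
    linarith
  have hi : ∀ R : ℝ, ContinuousOn F (Metric.sphere 0 R) →
      IntegrableOn F (Metric.sphere 0 R) (Measure.hausdorffMeasure 1) := by
    intro R hR
    have : IsFiniteMeasure ((Measure.hausdorffMeasure 1 : Measure ℂ).restrict (Metric.sphere 0 R)) :=
      ⟨by rw [Measure.restrict_apply_univ]; exact hausdorffMeasure_sphere_lt_top R⟩
    have := hR.integrableOn_compact (isCompact_sphere 0 R)
      (μ := (Measure.hausdorffMeasure 1 : Measure ℂ).restrict (Metric.sphere 0 R))
    rwa [IntegrableOn, Measure.restrict_restrict Metric.isClosed_sphere.measurableSet,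
      inter_self] at this
  have c1 := hF.mono subset_union_left
  have c2 := hF.mono subset_union_right
  rw [arcLength, frontier_annulus h0 h1, setIntegral_union hd Metric.isClosed_sphere.measurableSet
    (hi 1 c1) (hi r c2), setIntegral_sphere_eq one_pos c1, setIntegral_sphere_eq h0 c2]
  push_cast
  ring

theorem isFiniteMeasure_arcLength_annulus {r : ℝ} (h0 : 0 < r) (h1 : r < 1) :
    IsFiniteMeasure (arcLength (annulus r)) := ⟨by
  rw [arcLength, Measure.restrict_apply_univ, frontier_annulus h0 h1]
  exact measure_union_lt_top (hausdorffMeasure_sphere_lt_top 1) (hausdorffMeasure_sphere_lt_top r)⟩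

theorem memLp_arcLength_annulus {r : ℝ} (h0 : 0 < r) (h1 : r < 1) {F : ℂ → ℂ}
    (hF : ContinuousOn F (frontier (annulus r))) : MemLp F 2 (arcLength (annulus r)) := by
  have := isFiniteMeasure_arcLength_annulus h0 h1
  have hcl : IsClosed (frontier (annulus r)) := isClosed_frontier
  have hcpt : IsCompact (frontier (annulus r)) := by
    rw [frontier_annulus h0 h1]; exact (isCompact_sphere 0 1).union (isCompact_sphere 0 r)
  obtain ⟨K, hK⟩ := hcpt.exists_bound_of_continuousOn hF
  exact MemLp.of_bound (hF.aestronglyMeasurable hcl.measurableSet) K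
    ((ae_restrict_iff' hcl.measurableSet).mpr (Eventually.of_forall hK))

/-! ### Cauchy's formula and Laurent series on an annulus -/

/-- The exceptional set `s` is there for difference quotients `dslope f a`, which are only known to
be continuous at `a`. -/
theorem circleAverage_eq_of_differentiableOn_annulus {ρ₁ ρ₂ : ℝ} (h1 : 0 < ρ₁) (h2 : ρ₁ ≤ ρ₂)
    {f : ℂ → ℂ} {s : Set ℂ} (hs : s.Countable)
    (hc : ContinuousOn f {z | ρ₁ ≤ ‖z‖ ∧ ‖z‖ ≤ ρ₂})
    (hd : ∀ z, ρ₁ < ‖z‖ → ‖z‖ < ρ₂ → z ∉ s → DifferentiableAt ℂ f z) :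
    Real.circleAverage f 0 ρ₂ = Real.circleAverage f 0 ρ₁ := by
  rw [Real.circleAverage_eq_circleIntegral h1.ne',
    Real.circleAverage_eq_circleIntegral (h1.trans_le h2).ne']
  congr 1
  refine Complex.circleIntegral_sub_center_inv_smul_eq_of_differentiable_on_annulus_off_countable
    h1 h2 hs (hc.mono ?_) ?_
  · rintro z ⟨ha, hb⟩
    simp only [Metric.mem_closedBall, dist_zero_right, Metric.mem_ball, not_lt] at ha hb
    exact ⟨hb, ha⟩
  · rintro z ⟨⟨ha, hb⟩, hz⟩
    simp only [Metric.mem_closedBall, dist_zero_right, Metric.mem_ball, not_le] at ha hb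
    exact hd z hb ha hz

theorem circleAverage_div_sub_of_norm_lt {R : ℝ} {a : ℂ} (h : ‖a‖ < R) :
    Real.circleAverage (fun z => z / (z - a)) 0 R = 1 := by
  have hR : 0 < R := (norm_nonneg a).trans_lt h
  rw [Real.circleAverage_eq_circleIntegral hR.ne']
  have : (∮ z in C(0, R), (z - 0)⁻¹ • (z / (z - a))) = ∮ z in C(0, R), (z - a)⁻¹ := by
    refine circleIntegral.integral_congr hR.le fun z hz => ?_
    have hz : z ≠ 0 := by
      rintro rfl
      simp at hz; linarith
    simp only [sub_zero, smul_eq_mul, div_eq_mul_inv]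
    field_simp
  rw [this, circleIntegral.integral_sub_inv_of_mem_ball (by simpa using h), smul_eq_mul]
  exact inv_mul_cancel₀ Complex.two_pi_I_ne_zero

theorem circleAverage_div_sub_of_lt_norm {R : ℝ} (hR : 0 < R) {a : ℂ} (h : R < ‖a‖) :
    Real.circleAverage (fun z => z / (z - a)) 0 R = 0 := by
  rw [Real.circleAverage_eq_circleIntegral hR.ne']
  have : (∮ z in C(0, R), (z - 0)⁻¹ • (z / (z - a))) = ∮ z in C(0, R), (z - a)⁻¹ := by
    refine circleIntegral.integral_congr hR.le fun z hz => ?_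
    have hz : z ≠ 0 := by
      rintro rfl
      simp at hz; linarith
    simp only [sub_zero, smul_eq_mul, div_eq_mul_inv]
    field_simp
  have hne : ∀ z ∈ Metric.closedBall (0 : ℂ) R, z - a ≠ 0 := by
    intro z hz h0
    rw [sub_eq_zero.mp h0, mem_closedBall_zero_iff] at hz
    linarith
  have h0 : (∮ z in C(0, R), (z - a)⁻¹) = 0 := by
    refine Complex.circleIntegral_eq_zero_of_differentiable_on_off_countable hR.le
      countable_empty ?_ ?_
    · exact (continuousOn_id.sub continuousOn_const).inv₀ hne
    · intro z hz
      exact ((differentiableAt_id).sub_const a).inv (hne z (Metric.ball_subset_closedBall hz.1))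
  rw [this, h0, smul_zero]

/-- In circle averages the Cauchy kernel reads `z / (z - a)`. The function `z * dslope f a z` has
the same average over both circles; splitting it into `f z * (z / (z - a))` minus `f a * (z / (z -
a))` gives the formula, as the kernel itself averages to 1 outside `a` and to 0 inside. -/
theorem cauchy_formula_annulus {ρ₁ ρ₂ : ℝ} (h1 : 0 < ρ₁) {f : ℂ → ℂ}
    (hc : ContinuousOn f {z | ρ₁ ≤ ‖z‖ ∧ ‖z‖ ≤ ρ₂})
    (hd : DifferentiableOn ℂ f {z | ρ₁ < ‖z‖ ∧ ‖z‖ < ρ₂}) {a : ℂ} (ha1 : ρ₁ < ‖a‖)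
    (ha2 : ‖a‖ < ρ₂) :
    Real.circleAverage (fun z => f z * (z / (z - a))) 0 ρ₂ -
      Real.circleAverage (fun z => f z * (z / (z - a))) 0 ρ₁ = f a := by
  have hopen : IsOpen {z : ℂ | ρ₁ < ‖z‖ ∧ ‖z‖ < ρ₂} :=
    (isOpen_lt continuous_const continuous_norm).inter (isOpen_lt continuous_norm continuous_const)
  have hda : DifferentiableAt ℂ f a := hd.differentiableAt (hopen.mem_nhds ⟨ha1, ha2⟩)
  have hnhds : {z : ℂ | ρ₁ ≤ ‖z‖ ∧ ‖z‖ ≤ ρ₂} ∈ 𝓝 a :=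
    mem_of_superset (hopen.mem_nhds ⟨ha1, ha2⟩) fun z hz => ⟨hz.1.le, hz.2.le⟩
  have heq := circleAverage_eq_of_differentiableOn_annulus h1 (ha1.trans ha2).le
    (f := fun z => z * dslope f a z) (countable_singleton a)
    (continuousOn_id.mul ((continuousOn_dslope hnhds).mpr ⟨hc, hda⟩)) (by
      intro z hz1 hz2 hza
      exact differentiableAt_id.mul ((differentiableAt_dslope_of_ne hza).mpr
        (hd.differentiableAt (hopen.mem_nhds ⟨hz1, hz2⟩))))
  have key : ∀ R : ℝ, 0 < R → R ≠ ‖a‖ → ρ₁ ≤ R → R ≤ ρ₂ →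
      Real.circleAverage (fun z => z * dslope f a z) 0 R =
        Real.circleAverage (fun z => f z * (z / (z - a))) 0 R -
          f a * Real.circleAverage (fun z => z / (z - a)) 0 R := by
    intro R hR hRa hR1 hR2
    have hne : ∀ z ∈ Metric.sphere (0 : ℂ) R, z - a ≠ 0 := by
      intro z hz h0
      rw [sub_eq_zero.mp h0, mem_sphere_zero_iff_norm] at hz
      exact hRa hz.symm
    have hcR : ContinuousOn (fun z : ℂ => z / (z - a)) (Metric.sphere 0 R) :=
      continuousOn_id.div (continuousOn_id.sub continuousOn_const) hne
    have hfR : ContinuousOn f (Metric.sphere 0 R) := hc.mono fun z hz => by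
      rw [mem_sphere_zero_iff_norm] at hz; exact ⟨by rw [hz]; exact hR1, by rw [hz]; exact hR2⟩
    have e1 : f a * Real.circleAverage (fun z => z / (z - a)) 0 R =
        Real.circleAverage (fun z => f a * (z / (z - a))) 0 R := by
      have := Real.circleAverage_fun_smul (a := f a) (f := fun z : ℂ => z / (z - a)) (c := 0) (R := R)
      simpa using this.symm
    rw [e1, ← Real.circleAverage_fun_sub]
    · refine Real.circleAverage_congr_sphere fun z hz => ?_
      rw [abs_of_pos hR] at hz
      have hza : z ≠ a := sub_ne_zero.mp (hne z hz)
      have := hne z hz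
      simp only [dslope_of_ne f hza, slope_def_field]
      field_simp
    · exact (hfR.mul hcR).circleIntegrable hR.le
    · exact (continuousOn_const.mul hcR).circleIntegrable hR.le
  rw [key ρ₂ (by linarith) ha2.ne' (by linarith) le_rfl, key ρ₁ h1 ha1.ne le_rfl (by linarith),
    circleAverage_div_sub_of_norm_lt ha2, circleAverage_div_sub_of_lt_norm h1 ha1] at heq
  linear_combination heq

theorem hasSum_circleAverage_geometric {R ρ : ℝ} (hR : 0 < R) (hρ : ρ < 1) {f h : ℂ → ℂ}
    (hf : ContinuousOn f (Metric.sphere 0 R)) (hh : ContinuousOn h (Metric.sphere 0 R))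
    (hb : ∀ z ∈ Metric.sphere (0 : ℂ) R, ‖h z‖ ≤ ρ) :
    HasSum (fun n : ℕ => Real.circleAverage (fun z => f z * h z ^ n) 0 R)
      (Real.circleAverage (fun z => f z * (1 - h z)⁻¹) 0 R) := by
  have hmem : ∀ θ, circleMap 0 R θ ∈ Metric.sphere (0 : ℂ) R := fun θ =>
    circleMap_mem_sphere 0 hR.le θ
  have hρ0 : 0 ≤ ρ := (norm_nonneg _).trans (hb _ (hmem 0))
  have hcf : Continuous fun θ => f (circleMap 0 R θ) :=
    hf.comp_continuous (continuous_circleMap 0 R) hmem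
  have hch : Continuous fun θ => h (circleMap 0 R θ) :=
    hh.comp_continuous (continuous_circleMap 0 R) hmem
  refine HasSum.const_smul _ ?_
  refine intervalIntegral.hasSum_integral_of_dominated_convergence
    (fun n θ => ‖f (circleMap 0 R θ)‖ * ρ ^ n) (fun n => ?_) (fun n => ?_) ?_ ?_ ?_
  · exact (hcf.mul (hch.pow n)).aestronglyMeasurable
  · refine Eventually.of_forall fun θ _ => ?_
    rw [norm_mul, norm_pow]
    gcongr
    exact hb _ (hmem θ)
  · exact Eventually.of_forall fun _ _ => (summable_geometric_of_lt_one hρ0 hρ).mul_left _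
  · simp only [tsum_mul_left]
    exact (hcf.norm.mul continuous_const).intervalIntegrable _ _
  · refine Eventually.of_forall fun θ _ => HasSum.mul_left _ ?_
    exact hasSum_geometric_of_norm_lt_one ((hb _ (hmem θ)).trans_lt hρ)

/-- In Cauchy's formula the kernel is expanded geometrically, in `a / z` on the outer circle and in
`z / a` on the inner one. The inner coefficients are then moved to the outer circle. -/
theorem hasSum_laurent_annulus {ρ₁ ρ₂ : ℝ} (h1 : 0 < ρ₁) {f : ℂ → ℂ}
    (hc : ContinuousOn f {z | ρ₁ ≤ ‖z‖ ∧ ‖z‖ ≤ ρ₂})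
    (hd : DifferentiableOn ℂ f {z | ρ₁ < ‖z‖ ∧ ‖z‖ < ρ₂}) {a : ℂ} (ha1 : ρ₁ < ‖a‖)
    (ha2 : ‖a‖ < ρ₂) :
    HasSum (fun n : ℤ => a ^ n * Real.circleAverage (fun z => f z * z ^ (-n)) 0 ρ₂) (f a) := by
  have h12 : ρ₁ < ρ₂ := ha1.trans ha2
  have h2 : 0 < ρ₂ := h1.trans h12
  have ha0 : a ≠ 0 := norm_pos_iff.mp (h1.trans ha1)
  have hs1 : Metric.sphere (0 : ℂ) ρ₁ ⊆ {z | ρ₁ ≤ ‖z‖ ∧ ‖z‖ ≤ ρ₂} := fun z hz => by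
    rw [mem_sphere_zero_iff_norm] at hz; exact ⟨hz.ge, hz.le.trans h12.le⟩
  have hs2 : Metric.sphere (0 : ℂ) ρ₂ ⊆ {z | ρ₁ ≤ ‖z‖ ∧ ‖z‖ ≤ ρ₂} := fun z hz => by
    rw [mem_sphere_zero_iff_norm] at hz; exact ⟨h12.le.trans hz.ge, hz.le⟩
  have hne : ∀ z ∈ {z : ℂ | ρ₁ ≤ ‖z‖ ∧ ‖z‖ ≤ ρ₂}, z ≠ 0 := fun z hz =>
    norm_pos_iff.mp (h1.trans_le hz.1)
  have hmul : ∀ (b : ℂ) (g : ℂ → ℂ) (R : ℝ),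
      b * Real.circleAverage g 0 R = Real.circleAverage (fun z => b * g z) 0 R := by
    intro b g R
    have := Real.circleAverage_fun_smul (a := b) (f := g) (c := 0) (R := R)
    simpa using this.symm
  have hopen : IsOpen {z : ℂ | ρ₁ < ‖z‖ ∧ ‖z‖ < ρ₂} :=
    (isOpen_lt continuous_const continuous_norm).inter (isOpen_lt continuous_norm continuous_const)
  have hcoef : ∀ n : ℤ, Real.circleAverage (fun z => f z * z ^ (-n)) 0 ρ₂ =
      Real.circleAverage (fun z => f z * z ^ (-n)) 0 ρ₁ := by
    intro n
    refine circleAverage_eq_of_differentiableOn_annulus h1 h12.le countable_empty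
      (hc.mul fun z hz => (continuousAt_zpow₀ z (-n) (Or.inl (hne z hz))).continuousWithinAt) ?_
    intro z hz1 hz2 _
    exact (hd.differentiableAt (hopen.mem_nhds ⟨hz1, hz2⟩)).mul
      (differentiableAt_zpow.mpr (Or.inl (hne z ⟨hz1.le, hz2.le⟩)))
  have hA := hasSum_circleAverage_geometric (R := ρ₂) (ρ := ‖a‖ / ρ₂) h2 ((div_lt_one h2).mpr ha2)
    (h := fun z => a / z) (hc.mono hs2)
    (continuousOn_const.div continuousOn_id fun z hz => hne z (hs2 hz)) (by
      intro z hz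
      rw [mem_sphere_zero_iff_norm] at hz
      rw [norm_div, hz])
  -- The extra factor `z / a` shifts the series to start at the first power, so the inner circle
  -- supplies exactly the indices `-(n + 1)` and the outer circle keeps `n = 0`.
  have hB := hasSum_circleAverage_geometric (R := ρ₁) (ρ := ρ₁ / ‖a‖) h1
    ((div_lt_one (h1.trans ha1)).mpr ha1) (f := fun z => f z * (z / a)) (h := fun z => z / a)
    ((hc.mono hs1).mul (continuousOn_id.div_const a)) (continuousOn_id.div_const a) (by
      intro z hz
      rw [mem_sphere_zero_iff_norm] at hz
      rw [norm_div, hz])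
  have hA' : Real.circleAverage (fun z => f z * (1 - a / z)⁻¹) 0 ρ₂ =
      Real.circleAverage (fun z => f z * (z / (z - a))) 0 ρ₂ := by
    refine Real.circleAverage_congr_sphere fun z hz => ?_
    rw [abs_of_pos h2] at hz
    have hz0 := hne z (hs2 hz)
    have hza : z - a ≠ 0 := by
      intro h0
      rw [sub_eq_zero.mp h0, mem_sphere_zero_iff_norm] at hz; linarith
    have : 1 - a / z = (z - a) / z := by field_simp
    simp only [this, inv_div]
  have hB' : Real.circleAverage (fun z => f z * (z / a) * (1 - z / a)⁻¹) 0 ρ₁ =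
      -Real.circleAverage (fun z => f z * (z / (z - a))) 0 ρ₁ := by
    rw [neg_eq_neg_one_mul, hmul]
    refine Real.circleAverage_congr_sphere fun z hz => ?_
    rw [abs_of_pos h1] at hz
    have hza : a - z ≠ 0 := by
      intro h0
      rw [← sub_eq_zero.mp h0, mem_sphere_zero_iff_norm] at hz; linarith
    have hza' : z - a ≠ 0 := by rw [← neg_sub]; exact neg_ne_zero.mpr hza
    have : 1 - z / a = (a - z) / a := by field_simp
    simp only [this, inv_div]
    field_simp
    ring
  rw [hA'] at hA
  rw [hB'] at hB
  have := HasSum.of_nat_of_neg_add_one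
    (f := fun n : ℤ => a ^ n * Real.circleAverage (fun z => f z * z ^ (-n)) 0 ρ₂)
    (hA.congr_fun fun n => ?_) (hB.congr_fun fun n => ?_)
  · rwa [← sub_eq_add_neg, cauchy_formula_annulus h1 hc hd ha1 ha2] at this
  · rw [hmul]
    refine Real.circleAverage_congr_sphere fun z hz => ?_
    simp [div_eq_mul_inv]; ring
  · rw [hcoef, hmul]
    refine Real.circleAverage_congr_sphere fun z hz => ?_
    have h1 : a ^ (-((n : ℤ) + 1)) = (a ^ (n + 1))⁻¹ := by
      rw [zpow_neg]; norm_cast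
    have h2 : z ^ (- -((n : ℤ) + 1)) = z ^ (n + 1) := by
      rw [neg_neg]; norm_cast
    simp only [h1, h2, div_pow]
    field_simp
    ring

/-! ### The Szegő kernel of an annulus as a series -/

/-- By uniqueness, any element with the reproducing property is the kernel. This is applied both to
the Laurent-type series and to the infinite product, and thereby identifies the two on the diagonal
without a direct proof of the series-product identity. -/
theorem RepresentsEvaluation.szegoRepresenter_eq {Ω : Set ℂ} {ζ : ℂ} {k : Lp ℂ 2 (arcLength Ω)}
    (hk : RepresentsEvaluation Ω ζ k) : szegoRepresenter Ω ζ = k := by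
  have h : ∃ k, RepresentsEvaluation Ω ζ k := ⟨k, hk⟩
  rw [szegoRepresenter, dif_pos h]
  exact h.choose_spec.unique hk

theorem ne_zero_of_mem_closure_annulus {r : ℝ} (h0 : 0 < r) (h1 : r < 1) {z : ℂ}
    (hz : z ∈ closure (annulus r)) : z ≠ 0 := by
  rw [closure_annulus h0 h1] at hz
  exact norm_pos_iff.mp (h0.trans_le hz.1)

theorem inner_eq_circleAverage {r : ℝ} (h0 : 0 < r) (h1 : r < 1) {F G : ℂ → ℂ}
    (hF : ContinuousOn F (frontier (annulus r))) (hG : ContinuousOn G (frontier (annulus r)))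
    {k g : Lp ℂ 2 (arcLength (annulus r))} (hk : k =ᵐ[arcLength (annulus r)] F)
    (hg : g =ᵐ[arcLength (annulus r)] G) :
    inner ℂ k g = unitCircleLength * (Real.circleAverage (fun z => G z * star (F z)) 0 1 +
      r * Real.circleAverage (fun z => G z * star (F z)) 0 r) := by
  rw [L2.inner_def, ← integral_arcLength_annulus h0 h1
    (F := fun z => G z * star (F z)) (hG.mul hF.star)]
  refine integral_congr_ae ?_
  filter_upwards [hk, hg] with z hz hz'
  rw [hz, hz']
  rfl

/-- The boundary trace of `z ^ n` on an annulus. -/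
noncomputable def zpowTrace {r : ℝ} (h0 : 0 < r) (h1 : r < 1) (n : ℤ) :
    Lp ℂ 2 (arcLength (annulus r)) :=
  (memLp_arcLength_annulus h0 h1 (F := fun z => z ^ n) (fun _ hz =>
    (continuousAt_zpow₀ _ n (Or.inl (ne_zero_of_mem_closure_annulus h0 h1
      (frontier_subset_closure hz)))).continuousWithinAt)).toLp

theorem zpowTrace_ae_eq {r : ℝ} (h0 : 0 < r) (h1 : r < 1) (n : ℤ) :
    zpowTrace h0 h1 n =ᵐ[arcLength (annulus r)] fun z => z ^ n :=
  MemLp.coeFn_toLp _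

theorem isSmoothHolomorphic_of_differentiableOn {r : ℝ} {f : ℂ → ℂ} {U : Set ℂ} (hU : IsOpen U)
    (hf : DifferentiableOn ℂ f U) (hsub : closure (annulus r) ⊆ U) :
    IsSmoothHolomorphic (annulus r) f :=
  ⟨hf.mono (subset_closure.trans hsub),
    ((hf.contDiffOn hU).restrict_scalars ℝ).mono hsub⟩

theorem isSmoothHolomorphic_zpow {r : ℝ} (h0 : 0 < r) (h1 : r < 1) (n : ℤ) :
    IsSmoothHolomorphic (annulus r) (fun z => z ^ n) :=
  isSmoothHolomorphic_of_differentiableOn (U := {0}ᶜ) isOpen_compl_singleton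
    (fun _ hz => (differentiableAt_zpow.mpr (Or.inl hz)).differentiableWithinAt)
    fun _ hz => ne_zero_of_mem_closure_annulus h0 h1 hz

theorem IsSmoothHolomorphic.continuousOn_frontier {Ω : Set ℂ} {f : ℂ → ℂ}
    (hf : IsSmoothHolomorphic Ω f) : ContinuousOn f (frontier Ω) :=
  hf.2.continuousOn.mono frontier_subset_closure

/-- On the circle of radius `ρ` the conjugate of `z ^ n` is `ρ ^ (2 * n) * z ^ (-n)`, so both
boundary circles see the same Laurent coefficient of `f`. The outer one contributes weight 1, the
inner one `r * r ^ (2 * n)`, the factor `r` coming from arc length. -/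
theorem inner_zpowTrace {r : ℝ} (h0 : 0 < r) (h1 : r < 1) (n : ℤ) {f : ℂ → ℂ}
    {g : Lp ℂ 2 (arcLength (annulus r))} (hf : IsSmoothHolomorphic (annulus r) f)
    (hg : g =ᵐ[arcLength (annulus r)] f) :
    inner ℂ (zpowTrace h0 h1 n) g = (unitCircleLength * (1 + r ^ (2 * n + 1)) : ℝ) *
      Real.circleAverage (fun z => f z * z ^ (-n)) 0 1 := by
  rw [inner_eq_circleAverage h0 h1 (isSmoothHolomorphic_zpow h0 h1 n).continuousOn_frontier
    hf.continuousOn_frontier (zpowTrace_ae_eq h0 h1 n) hg]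
  have hc := hf.2.continuousOn
  rw [closure_annulus h0 h1] at hc
  have hcoef : Real.circleAverage (fun z => f z * z ^ (-n)) 0 1 =
      Real.circleAverage (fun z => f z * z ^ (-n)) 0 r := by
    refine circleAverage_eq_of_differentiableOn_annulus h0 h1.le countable_empty
      (hc.mul fun z hz => (continuousAt_zpow₀ z (-n)
        (Or.inl (norm_pos_iff.mp (h0.trans_le hz.1)))).continuousWithinAt) ?_
    intro z hz1 hz2 _
    exact (hf.1.differentiableAt ((isOpen_annulus r).mem_nhds ⟨hz1, hz2⟩)).mul
      (differentiableAt_zpow.mpr (Or.inl (norm_pos_iff.mp (h0.trans hz1))))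
  have hconj : ∀ z : ℂ, z ≠ 0 → star (z ^ n) = ((‖z‖ ^ (2 * n) : ℝ) : ℂ) * z ^ (-n) := by
    intro z hz
    have h2 : star z = ((‖z‖ ^ 2 : ℝ) : ℂ) * z⁻¹ := by
      rw [eq_mul_inv_iff_mul_eq₀ hz, mul_comm, Complex.star_def, Complex.mul_conj, Complex.normSq_eq_norm_sq]
    rw [star_zpow₀, h2, mul_zpow, inv_zpow, zpow_neg, zpow_mul]
    push_cast
    rfl
  have e1 : Real.circleAverage (fun z => f z * star (z ^ n)) 0 1 =
      Real.circleAverage (fun z => f z * z ^ (-n)) 0 1 := by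
    refine Real.circleAverage_congr_sphere fun z hz => ?_
    have hz : ‖z‖ = 1 := by simpa using hz
    simp only [hconj z (norm_pos_iff.mp (by rw [hz]; exact one_pos)), hz, one_zpow,
      Complex.ofReal_one, one_mul]
  have e2 : Real.circleAverage (fun z => f z * star (z ^ n)) 0 r =
      (r ^ (2 * n) : ℝ) * Real.circleAverage (fun z => f z * z ^ (-n)) 0 r := by
    have := Real.circleAverage_fun_smul (a := ((r ^ (2 * n) : ℝ) : ℂ))
      (f := fun z : ℂ => f z * z ^ (-n)) (c := 0) (R := r)
    rw [smul_eq_mul] at this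
    rw [← this]
    refine Real.circleAverage_congr_sphere fun z hz => ?_
    have hz : ‖z‖ = r := by simpa [abs_of_pos h0] using hz
    simp only [hconj z (norm_pos_iff.mp (by rw [hz]; exact h0)), hz, smul_eq_mul]
    ring
  have hr : (r : ℂ) ^ (2 * n + 1) = r * (r : ℂ) ^ (2 * n) := by
    rw [zpow_add₀ (by exact_mod_cast h0.ne'), zpow_one, mul_comm]
  rw [e1, e2, ← hcoef]
  push_cast
  rw [hr]
  ring

theorem norm_zpowTrace {r : ℝ} (h0 : 0 < r) (h1 : r < 1) (n : ℤ) :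
    ‖zpowTrace h0 h1 n‖ = √(unitCircleLength * (1 + r ^ (2 * n + 1))) := by
  have h := inner_zpowTrace h0 h1 n (isSmoothHolomorphic_zpow h0 h1 n) (zpowTrace_ae_eq h0 h1 n)
  have hone : Real.circleAverage (fun z : ℂ => z ^ n * z ^ (-n)) 0 1 = 1 := by
    have : Real.circleAverage (fun z : ℂ => z ^ n * z ^ (-n)) 0 1 =
        Real.circleAverage (fun _ : ℂ => (1 : ℂ)) 0 1 := by
      refine Real.circleAverage_congr_sphere fun z hz => ?_
      have hz : ‖z‖ = 1 := by simpa using hz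
      have hz0 : z ≠ 0 := norm_pos_iff.mp (by rw [hz]; exact one_pos)
      simp only [← zpow_add₀ hz0, add_neg_cancel, zpow_zero]
    rw [this, Real.circleAverage_const]
  rw [hone, mul_one, inner_self_eq_norm_sq_to_K] at h
  have h' : ‖zpowTrace h0 h1 n‖ ^ 2 = unitCircleLength * (1 + r ^ (2 * n + 1)) :=
    Complex.ofReal_injective (by push_cast at h ⊢; exact h)
  rw [← h', Real.sqrt_sq (norm_nonneg _)]

theorem zpowTrace_mem_hardySpace {r : ℝ} (h0 : 0 < r) (h1 : r < 1) (n : ℤ) :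
    zpowTrace h0 h1 n ∈ hardySpace (annulus r) :=
  (smoothTraces (annulus r)).le_topologicalClosure
    ⟨_, isSmoothHolomorphic_zpow h0 h1 n, zpowTrace_ae_eq h0 h1 n⟩

/-- The `n`-th term of the expansion of the Szegő kernel of an annulus. -/
noncomputable def szegoKernelTerm {r : ℝ} (h0 : 0 < r) (h1 : r < 1) (ζ : ℂ) (n : ℤ) :
    Lp ℂ 2 (arcLength (annulus r)) :=
  (star (ζ ^ n) * ((unitCircleLength * (1 + r ^ (2 * n + 1)))⁻¹ : ℝ) : ℂ) • zpowTrace h0 h1 n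

/-- The `L²` norms decay geometrically, with ratio `‖ζ‖` for positive indices and `r / ‖ζ‖` for
negative ones. -/
theorem summable_szegoKernelTerm {r : ℝ} (h0 : 0 < r) (h1 : r < 1) {ζ : ℂ} (hζ : ζ ∈ annulus r) :
    Summable (szegoKernelTerm h0 h1 ζ) := by
  have hC := unitCircleLength_pos
  have hζ0 : 0 < ‖ζ‖ := h0.trans hζ.1
  have hb : ∀ n : ℤ, 0 < 1 + r ^ (2 * n + 1) := fun n => by positivity
  have hnorm : ∀ n, ‖szegoKernelTerm h0 h1 ζ n‖ =
      ‖ζ‖ ^ n * (√(unitCircleLength * (1 + r ^ (2 * n + 1))))⁻¹ := by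
    intro n
    have hp : 0 < unitCircleLength * (1 + r ^ (2 * n + 1)) := mul_pos hC (hb n)
    rw [szegoKernelTerm, norm_smul, norm_zpowTrace, norm_mul, norm_star, norm_zpow,
      Complex.norm_real, Real.norm_of_nonneg (inv_nonneg.mpr hp.le), mul_assoc]
    congr 1
    have := Real.sq_sqrt hp.le
    have h' : 0 < √(unitCircleLength * (1 + r ^ (2 * n + 1))) := Real.sqrt_pos.mpr hp
    field_simp
    rw [this]
  apply Summable.of_norm
  simp only [hnorm]
  apply Summable.of_nat_of_neg
  · refine Summable.of_nonneg_of_le (fun n => by positivity) (fun n => ?_)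
      ((summable_geometric_of_lt_one (norm_nonneg ζ) hζ.2).mul_right (√unitCircleLength)⁻¹)
    rw [zpow_natCast]
    gcongr
    have : 0 < r ^ (2 * (n : ℤ) + 1) := by positivity
    nlinarith
  · refine Summable.of_nonneg_of_le (fun n => by positivity) (fun n => ?_)
      ((summable_geometric_of_lt_one (r := r / ‖ζ‖) (by positivity)
        ((div_lt_one hζ0).mpr hζ.1)).mul_right (√(unitCircleLength * r))⁻¹)
    -- For negative indices the summand 1 is dropped, as `r ^ (-2 * n + 1)` dominates.
    have h2 : √(unitCircleLength * r) * (r ^ n)⁻¹ ≤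
        √(unitCircleLength * (1 + r ^ (2 * (-(n : ℤ)) + 1))) := by
      apply Real.le_sqrt_of_sq_le
      rw [mul_pow, Real.sq_sqrt (by positivity)]
      have : r ^ (2 * (-(n : ℤ)) + 1) = r * ((r ^ n)⁻¹) ^ 2 := by
        rw [zpow_add₀ h0.ne', mul_comm 2, zpow_mul, zpow_neg, zpow_natCast]
        norm_cast
        ring
      rw [this]
      nlinarith
    rw [zpow_neg, zpow_natCast, div_pow]
    calc (‖ζ‖ ^ n)⁻¹ * (√(unitCircleLength * (1 + r ^ (2 * (-(n : ℤ)) + 1))))⁻¹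
        ≤ (‖ζ‖ ^ n)⁻¹ * (√(unitCircleLength * r) * (r ^ n)⁻¹)⁻¹ := by
          gcongr
      _ = _ := by
          rw [mul_inv, inv_inv, div_eq_mul_inv]; ring

/-- Pairing the series termwise with a trace reproduces the Laurent series of `f` at `ζ`; the
coefficients were chosen to cancel the norms of the powers. -/
theorem representsEvaluation_tsum_szegoKernelTerm {r : ℝ} (h0 : 0 < r) (h1 : r < 1) {ζ : ℂ}
    (hζ : ζ ∈ annulus r) :
    RepresentsEvaluation (annulus r) ζ (∑' n, szegoKernelTerm h0 h1 ζ n) := by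
  have hC := unitCircleLength_pos
  have hs := (summable_szegoKernelTerm h0 h1 hζ).hasSum
  constructor
  · refine (Submodule.isClosed_topologicalClosure _).mem_of_tendsto hs (Eventually.of_forall fun s => ?_)
    exact Submodule.sum_mem _ fun n _ =>
      Submodule.smul_mem _ _ (zpowTrace_mem_hardySpace h0 h1 n)
  · intro f g hf hg
    -- The pairing is linear only in its second slot, so the sum is taken there and conjugated
    -- afterwards.
    have h2 := hs.mapL (innerSL ℂ g)
    have h3 := (Complex.hasSum_conj'.mpr h2)
    simp only [innerSL_apply_apply, inner_conj_symm] at h3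
    have hc := hf.2.continuousOn
    rw [closure_annulus h0 h1] at hc
    refine h3.unique ((hasSum_laurent_annulus h0 hc hf.1 hζ.1 hζ.2).congr_fun fun n => ?_)
    rw [szegoKernelTerm, inner_smul_left, inner_zpowTrace h0 h1 n hf hg]
    have hb : (1 + (r : ℂ) ^ (2 * n + 1)) ≠ 0 := by
      have : 0 < 1 + r ^ (2 * n + 1) := by positivity
      exact_mod_cast this.ne'
    have hC' : (unitCircleLength : ℂ) ≠ 0 := by exact_mod_cast hC.ne'
    simp only [map_mul, Complex.star_def, Complex.conj_conj, Complex.conj_ofReal]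
    push_cast
    field_simp

theorem szegoDiagonal_annulus {r : ℝ} (h0 : 0 < r) (h1 : r < 1) {ζ : ℂ}
    (hζ : ζ ∈ annulus r) :
    szegoDiagonal (annulus r) ζ = unitCircleLength⁻¹ * szegoMoment r 0 (Real.log ‖ζ‖) := by
  have hC := unitCircleLength_pos
  have hζ0 : 0 < ‖ζ‖ := h0.trans hζ.1
  have hk := representsEvaluation_tsum_szegoKernelTerm h0 h1 hζ
  have hs := (summable_szegoKernelTerm h0 h1 hζ).hasSum
  rw [szegoDiagonal, szegoKernel, hk.szegoRepresenter_eq]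
  have h2 := Complex.hasSum_re (hs.mapL (innerSL ℂ (∑' n, szegoKernelTerm h0 h1 ζ n)))
  simp only [innerSL_apply_apply] at h2
  rw [szegoMoment, ← tsum_mul_left, ← h2.tsum_eq]
  congr 1
  funext n
  rw [szegoKernelTerm, inner_smul_right, hk.2 _ _ (isSmoothHolomorphic_zpow h0 h1 n)
    (zpowTrace_ae_eq h0 h1 n)]
  have h3 : star (ζ ^ n) * ζ ^ n = ((Real.exp (2 * n * Real.log ‖ζ‖) : ℝ) : ℂ) := by
    rw [mul_comm, Complex.star_def, Complex.mul_conj, Complex.normSq_eq_norm_sq, norm_zpow]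
    congr 1
    have : 2 * (n : ℝ) * Real.log ‖ζ‖ = Real.log ((‖ζ‖ ^ n) ^ 2) := by
      rw [Real.log_pow, Real.log_zpow]; push_cast; ring
    rw [this, Real.exp_log (by positivity)]
  rw [mul_right_comm, h3, ← Complex.ofReal_mul, Complex.ofReal_re, szegoTerm, mul_inv]
  ring

/-! ### The infinite product `∏ (1 - q ^ k w)` -/

/-- The infinite product `∏ (1 - q ^ k w)` over `k ≥ 0`. -/
noncomputable def eulerProd (q : ℝ) (w : ℂ) : ℂ := ∏' k : ℕ, (1 + -((q : ℂ) ^ k * w))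

theorem summable_norm_pow_mul {q : ℝ} (h0 : 0 < q) (h1 : q < 1) (w : ℂ) :
    Summable fun k : ℕ => ‖-((q : ℂ) ^ k * w)‖ := by
  simpa [abs_of_pos h0] using (summable_geometric_of_lt_one h0.le h1).mul_right ‖w‖

theorem differentiable_eulerProd {q : ℝ} (h0 : 0 < q) (h1 : q < 1) :
    Differentiable ℂ (eulerProd q) := by
  have h : HasProdLocallyUniformlyOn (fun (k : ℕ) (w : ℂ) => 1 + -((q : ℂ) ^ k * w)) (eulerProd q)
      univ := by
    refine hasProdLocallyUniformlyOn_of_forall_compact isOpen_univ fun K _ hK => ?_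
    obtain ⟨M, hM⟩ := hK.isBounded.exists_norm_le
    refine Summable.hasProdUniformlyOn_nat_one_add hK
      ((summable_geometric_of_lt_one h0.le h1).mul_right M)
      (.of_forall fun n w hw => ?_) (fun n => by fun_prop)
    rw [norm_neg, norm_mul, norm_pow, Complex.norm_real, Real.norm_of_nonneg h0.le]
    gcongr
    exact hM w hw
  rw [← differentiableOn_univ]
  refine h.differentiableOn (.of_forall fun s => ?_) isOpen_univ
  simpa [Finset.prod_fn] using DifferentiableOn.finsetProd (fun _ _ ↦ by fun_prop)

/-- This functional equation is all that is needed to compare the products on the two boundary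
circles. -/
theorem eulerProd_eq {q : ℝ} (h0 : 0 < q) (h1 : q < 1) (w : ℂ) :
    eulerProd q w = (1 - w) * eulerProd q (q * w) := by
  unfold eulerProd
  have hm : ∀ w : ℂ, Multipliable fun k : ℕ => 1 + -((q : ℂ) ^ k * w) := fun w =>
    multipliable_one_add_of_summable (summable_norm_pow_mul h0 h1 w)
  have h2 : (fun k : ℕ => 1 + -((q : ℂ) ^ (k + 1) * w)) =
      fun k : ℕ => 1 + -((q : ℂ) ^ k * (q * w)) := by
    funext k; ring
  rw [tprod_eq_zero_mul' (h2 ▸ hm (q * w)), h2]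
  simp [sub_eq_add_neg]

theorem star_eulerProd {q : ℝ} (h0 : 0 < q) (h1 : q < 1) (w : ℂ) :
    star (eulerProd q w) = eulerProd q (star w) := by
  have hm : Multipliable fun k : ℕ => 1 + -((q : ℂ) ^ k * w) :=
    multipliable_one_add_of_summable (summable_norm_pow_mul h0 h1 w)
  have := hm.map_tprod (starRingEnd ℂ) continuous_star
  change starRingEnd ℂ (eulerProd q w) = _
  unfold eulerProd
  rw [this]
  simp

theorem eulerProd_ne_zero {q : ℝ} (h0 : 0 < q) (h1 : q < 1) {w : ℂ} (hw : ‖w‖ < 1) :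
    eulerProd q w ≠ 0 := by
  refine tprod_one_add_ne_zero_of_summable (fun k => ?_) (summable_norm_pow_mul h0 h1 w)
  intro h
  have h2 : (q : ℂ) ^ k * w = 1 := by linear_combination -h
  have h3 := congrArg norm h2
  rw [norm_mul, norm_pow, Complex.norm_real, Real.norm_of_nonneg h0.le, norm_one] at h3
  have h4 : q ^ k ≤ 1 := pow_le_one₀ h0.le h1.le
  nlinarith [norm_nonneg w]

/-! ### The Szegő kernel of an annulus as an infinite product -/

/-- Up to a constant factor the Szegő kernel of the annulus `A_r`, as a function of its first
argument. -/
noncomputable def thetaSzego (r : ℝ) (a z : ℂ) : ℂ :=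
  eulerProd (r ^ 2) (-r * (star a * z)) * eulerProd (r ^ 2) (-r / (star a * z)) /
    (eulerProd (r ^ 2) (star a * z) * eulerProd (r ^ 2) ((r ^ 2 : ℝ) / (star a * z)))

/-- Up to a constant factor and the pole `z / (z - a)` the Garabedian kernel of the annulus `A_r`. -/
noncomputable def thetaGarabedian (r : ℝ) (a z : ℂ) : ℂ :=
  eulerProd (r ^ 2) (-r * (a / z)) * eulerProd (r ^ 2) (-r / (a / z)) /
    (eulerProd (r ^ 2) ((r ^ 2 : ℝ) * (a / z)) * eulerProd (r ^ 2) ((r ^ 2 : ℝ) / (a / z)))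

/-- A neighbourhood of the closed annulus on which the kernels are regular. -/
def thetaDomain (r : ℝ) (a : ℂ) : Set ℂ :=
  {z | r * ‖a‖ < ‖z‖ ∧ r * ‖z‖ < ‖a‖ ∧ ‖a‖ * ‖z‖ < 1 ∧ r ^ 2 < ‖a‖ * ‖z‖}

theorem isOpen_thetaDomain (r : ℝ) (a : ℂ) : IsOpen (thetaDomain r a) := by
  have h1 : IsOpen {z : ℂ | r * ‖a‖ < ‖z‖} := isOpen_lt (by fun_prop) (by fun_prop)
  have h2 : IsOpen {z : ℂ | r * ‖z‖ < ‖a‖} := isOpen_lt (by fun_prop) (by fun_prop)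
  have h3 : IsOpen {z : ℂ | ‖a‖ * ‖z‖ < 1} := isOpen_lt (by fun_prop) (by fun_prop)
  have h4 : IsOpen {z : ℂ | r ^ 2 < ‖a‖ * ‖z‖} := isOpen_lt (by fun_prop) (by fun_prop)
  exact h1.inter (h2.inter (h3.inter h4))

section

variable {r : ℝ} {a : ℂ}

/-- The four inequalities of `thetaDomain` say that the arguments `r * a / z`, `r * z / a`, `star a
* z` and `r ^ 2 / (star a * z)` lie in the unit disc, where `eulerProd` has no zeros. So the
quotients extend holomorphically past the boundary. -/
theorem closure_annulus_subset_thetaDomain (h0 : 0 < r) (h1 : r < 1) (ha : a ∈ annulus r) :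
    closure (annulus r) ⊆ thetaDomain r a := by
  rw [closure_annulus h0 h1]
  rintro z ⟨hz1, hz2⟩
  obtain ⟨ha1, ha2⟩ := ha
  refine ⟨by nlinarith, by nlinarith, by nlinarith [norm_nonneg z], by nlinarith⟩

theorem thetaDomain_ne_zero {z : ℂ} (hz : z ∈ thetaDomain r a) :
    a ≠ 0 ∧ z ≠ 0 := by
  obtain ⟨-, -, -, h4⟩ := hz
  constructor
  · rintro rfl
    rw [norm_zero, zero_mul] at h4
    nlinarith
  · rintro rfl
    rw [norm_zero, mul_zero] at h4
    nlinarith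

theorem differentiableOn_thetaSzego (h0 : 0 < r) (h1 : r < 1) :
    DifferentiableOn ℂ (thetaSzego r a) (thetaDomain r a) := by
  intro z hz
  obtain ⟨ha, hz0⟩ := thetaDomain_ne_zero hz
  have hs : star a * z ≠ 0 := mul_ne_zero (star_ne_zero.mpr ha) hz0
  have hq0 : 0 < r ^ 2 := by positivity
  have hq1 : r ^ 2 < 1 := by nlinarith
  have hE : Differentiable ℂ (eulerProd (r ^ 2)) := differentiable_eulerProd hq0 hq1
  have hns : ‖star a * z‖ = ‖a‖ * ‖z‖ := by rw [norm_mul, norm_star]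
  have hd : DifferentiableAt ℂ (fun z => star a * z) z := by fun_prop
  refine DifferentiableAt.differentiableWithinAt ?_
  refine DifferentiableAt.div ?_ ?_ ?_
  · exact (hE.differentiableAt.comp z (hd.const_mul _)).mul
      (hE.differentiableAt.comp z (((differentiableAt_const _)).div hd hs))
  · exact (hE.differentiableAt.comp z hd).mul
      (hE.differentiableAt.comp z (((differentiableAt_const _)).div hd hs))
  · refine mul_ne_zero (eulerProd_ne_zero hq0 hq1 ?_) (eulerProd_ne_zero hq0 hq1 ?_)
    · rw [hns]; exact hz.2.2.1
    · rw [norm_div, hns, Complex.norm_real, Real.norm_of_nonneg hq0.le,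
        div_lt_one (hq0.trans hz.2.2.2)]
      exact hz.2.2.2

theorem thetaGarabedian_factors_ne_zero (h0 : 0 < r) (h1 : r < 1) {z : ℂ}
    (hz : z ∈ thetaDomain r a) :
    (eulerProd (r ^ 2) (-r * (a / z)) ≠ 0 ∧ eulerProd (r ^ 2) (-r / (a / z)) ≠ 0) ∧
    (eulerProd (r ^ 2) ((r ^ 2 : ℝ) * (a / z)) ≠ 0 ∧
      eulerProd (r ^ 2) ((r ^ 2 : ℝ) / (a / z)) ≠ 0) := by
  obtain ⟨ha, hz0⟩ := thetaDomain_ne_zero hz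
  have hq0 : 0 < r ^ 2 := by positivity
  have hq1 : r ^ 2 < 1 := by nlinarith
  have ha' : 0 < ‖a‖ := norm_pos_iff.mpr ha
  have hz' : 0 < ‖z‖ := norm_pos_iff.mpr hz0
  obtain ⟨g1, g2, -, -⟩ := hz
  have hr : r ^ 2 ≤ r := by nlinarith
  refine ⟨⟨eulerProd_ne_zero hq0 hq1 ?_, eulerProd_ne_zero hq0 hq1 ?_⟩,
    eulerProd_ne_zero hq0 hq1 ?_, eulerProd_ne_zero hq0 hq1 ?_⟩
  · rw [norm_mul, norm_neg, norm_div, Complex.norm_real, Real.norm_of_nonneg h0.le, ← mul_div_assoc,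
      div_lt_one hz']
    exact g1
  · rw [norm_div, norm_neg, norm_div, Complex.norm_real, Real.norm_of_nonneg h0.le, div_div_eq_mul_div,
      div_lt_one ha']
    exact g2
  · rw [norm_mul, norm_div, Complex.norm_real, Real.norm_of_nonneg hq0.le, ← mul_div_assoc,
      div_lt_one hz']
    exact lt_of_le_of_lt (by gcongr) g1
  · rw [norm_div, norm_div, Complex.norm_real, Real.norm_of_nonneg hq0.le, div_div_eq_mul_div,
      div_lt_one ha']
    exact lt_of_le_of_lt (by gcongr) g2

theorem thetaGarabedian_ne_zero (h0 : 0 < r) (h1 : r < 1) {z : ℂ} (hz : z ∈ thetaDomain r a) :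
    thetaGarabedian r a z ≠ 0 := by
  obtain ⟨⟨e1, e2⟩, e3, e4⟩ := thetaGarabedian_factors_ne_zero h0 h1 hz
  exact div_ne_zero (mul_ne_zero e1 e2) (mul_ne_zero e3 e4)

theorem differentiableOn_thetaGarabedian (h0 : 0 < r) (h1 : r < 1) :
    DifferentiableOn ℂ (thetaGarabedian r a) (thetaDomain r a) := by
  intro z hz
  obtain ⟨ha, hz0⟩ := thetaDomain_ne_zero hz
  obtain ⟨-, e3, e4⟩ := thetaGarabedian_factors_ne_zero h0 h1 hz
  have hq0 : 0 < r ^ 2 := by positivity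
  have hq1 : r ^ 2 < 1 := by nlinarith
  have hE : Differentiable ℂ (eulerProd (r ^ 2)) := differentiable_eulerProd hq0 hq1
  have hd : DifferentiableAt ℂ (fun z => a / z) z := (differentiableAt_const a).div
    differentiableAt_id hz0
  have hs : a / z ≠ 0 := div_ne_zero ha hz0
  refine DifferentiableAt.differentiableWithinAt ?_
  exact ((hE.differentiableAt.comp z (hd.const_mul _)).mul
      (hE.differentiableAt.comp z (((differentiableAt_const _)).div hd hs))).div
    ((hE.differentiableAt.comp z (hd.const_mul _)).mul
      (hE.differentiableAt.comp z (((differentiableAt_const _)).div hd hs))) (mul_ne_zero e3 e4)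

theorem star_thetaSzego (h0 : 0 < r) (h1 : r < 1) (z : ℂ) :
    star (thetaSzego r a z) = eulerProd (r ^ 2) (-r * (a * star z)) *
      eulerProd (r ^ 2) (-r / (a * star z)) / (eulerProd (r ^ 2) (a * star z) *
        eulerProd (r ^ 2) ((r ^ 2 : ℝ) / (a * star z))) := by
  have hq0 : 0 < r ^ 2 := by positivity
  have hq1 : r ^ 2 < 1 := by nlinarith
  have hr : ∀ x : ℝ, star (x : ℂ) = x := Complex.conj_ofReal
  simp only [thetaSzego, star_div₀, star_mul', star_eulerProd hq0 hq1, star_neg, star_star, hr]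

/-- Here `a * star z = a / z`, and the first factor `1 - a / z` of the product in the denominator
produces the pole. -/
theorem star_thetaSzego_of_norm_eq_one (h0 : 0 < r) (h1 : r < 1) (ha : a ∈ annulus r) {z : ℂ}
    (hz : ‖z‖ = 1) : star (thetaSzego r a z) = thetaGarabedian r a z * (z / (z - a)) := by
  have hq0 : 0 < r ^ 2 := by positivity
  have hq1 : r ^ 2 < 1 := by nlinarith
  have hz0 : z ≠ 0 := norm_pos_iff.mp (by rw [hz]; exact one_pos)
  have hza : z - a ≠ 0 := fun h => by rw [sub_eq_zero.mp h] at hz; exact ha.2.ne hz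
  have hst : a * star z = a / z := by
    rw [div_eq_mul_inv, Complex.inv_def, Complex.normSq_eq_norm_sq, hz]; simp
  have hmem : z ∈ thetaDomain r a := closure_annulus_subset_thetaDomain h0 h1 ha (by
    rw [closure_annulus h0 h1]; exact ⟨by rw [hz]; exact h1.le, hz.le⟩)
  obtain ⟨-, e3, e4⟩ := thetaGarabedian_factors_ne_zero h0 h1 hmem
  rw [star_thetaSzego h0 h1, hst, eulerProd_eq hq0 hq1 (a / z), thetaGarabedian]
  have : 1 - a / z = (z - a) / z := by field_simp
  rw [this]
  field_simp

/-- Here `a * star z = r ^ 2 * (a / z)`, and one application of the functional equation shifts each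
displaced factor back. In the resulting constant, `r⁻¹` will cancel the arc length factor `r` of the
inner circle and the minus sign is its orientation in Cauchy's formula. -/
theorem star_thetaSzego_of_norm_eq (h0 : 0 < r) (h1 : r < 1) (ha : a ∈ annulus r) {z : ℂ}
    (hz : ‖z‖ = r) :
    star (thetaSzego r a z) = -(r : ℂ)⁻¹ * (thetaGarabedian r a z * (z / (z - a))) := by
  have hq0 : 0 < r ^ 2 := by positivity
  have hq1 : r ^ 2 < 1 := by nlinarith
  have hz0 : z ≠ 0 := norm_pos_iff.mp (by rw [hz]; exact h0)
  have ha0 : a ≠ 0 := norm_pos_iff.mp (h0.trans ha.1)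
  have hr0 : (r : ℂ) ≠ 0 := by exact_mod_cast h0.ne'
  have hza : z - a ≠ 0 := fun h => by rw [sub_eq_zero.mp h] at hz; exact ha.1.ne' hz
  have hst : a * star z = (r ^ 2 : ℝ) * (a / z) := by
    rw [div_eq_mul_inv, Complex.inv_def, Complex.normSq_eq_norm_sq, hz, Complex.star_def]
    push_cast
    field_simp
  have hmem : z ∈ thetaDomain r a := closure_annulus_subset_thetaDomain h0 h1 ha (by
    rw [closure_annulus h0 h1]; exact ⟨hz.ge, by rw [hz]; exact h1.le⟩)
  obtain ⟨-, e3, e4⟩ := thetaGarabedian_factors_ne_zero h0 h1 hmem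
  rw [star_thetaSzego h0 h1, hst, thetaGarabedian]
  set v := a / z with hv
  have hv0 : v ≠ 0 := div_ne_zero ha0 hz0
  have k1 : eulerProd (r ^ 2) (-r * v) =
      (1 + r * v) * eulerProd (r ^ 2) (-r * ((r ^ 2 : ℝ) * v)) := by
    rw [eulerProd_eq hq0 hq1 (-r * v)]
    congr 1
    · ring
    · congr 1; ring
  have k2 : eulerProd (r ^ 2) (-r / ((r ^ 2 : ℝ) * v)) =
      (1 + r * v) / (r * v) * eulerProd (r ^ 2) (-r / v) := by
    rw [eulerProd_eq hq0 hq1 (-r / ((r ^ 2 : ℝ) * v))]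
    congr 1
    · push_cast; field_simp; ring
    · congr 1; push_cast; field_simp
  have k3 : eulerProd (r ^ 2) ((r ^ 2 : ℝ) / ((r ^ 2 : ℝ) * v)) =
      (v - 1) / v * eulerProd (r ^ 2) ((r ^ 2 : ℝ) / v) := by
    rw [eulerProd_eq hq0 hq1 ((r ^ 2 : ℝ) / ((r ^ 2 : ℝ) * v))]
    congr 1
    · push_cast; field_simp
    · congr 1; push_cast; field_simp
  have k4 : (v - 1) = -(z - a) / z := by rw [hv]; field_simp; ring
  have k5 : v - 1 ≠ 0 := by rw [k4]; exact div_ne_zero (neg_ne_zero.mpr hza) hz0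
  have k6 : z / (z - a) = -(v - 1)⁻¹ := by rw [k4]; field_simp
  rw [k1, k2, k3, k6]
  field_simp

end

/-! ### The Carathéodory metric of an annulus is a multiple of its Szegő kernel -/

section

variable {r : ℝ} {a : ℂ}

theorem isSmoothHolomorphic_thetaSzego (h0 : 0 < r) (h1 : r < 1) (ha : a ∈ annulus r) :
    IsSmoothHolomorphic (annulus r) (thetaSzego r a) :=
  isSmoothHolomorphic_of_differentiableOn (isOpen_thetaDomain r a)
    (differentiableOn_thetaSzego h0 h1) (closure_annulus_subset_thetaDomain h0 h1 ha)

theorem isSmoothHolomorphic_thetaGarabedian (h0 : 0 < r) (h1 : r < 1) (ha : a ∈ annulus r) :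
    IsSmoothHolomorphic (annulus r) (thetaGarabedian r a) :=
  isSmoothHolomorphic_of_differentiableOn (isOpen_thetaDomain r a)
    (differentiableOn_thetaGarabedian h0 h1) (closure_annulus_subset_thetaDomain h0 h1 ha)

/-- The boundary trace of `thetaSzego`. -/
noncomputable def thetaTrace (h0 : 0 < r) (h1 : r < 1) (ha : a ∈ annulus r) :
    Lp ℂ 2 (arcLength (annulus r)) :=
  (memLp_arcLength_annulus h0 h1
    (isSmoothHolomorphic_thetaSzego h0 h1 ha).continuousOn_frontier).toLp

theorem thetaTrace_ae_eq (h0 : 0 < r) (h1 : r < 1) (ha : a ∈ annulus r) :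
    thetaTrace h0 h1 ha =ᵐ[arcLength (annulus r)] thetaSzego r a :=
  MemLp.coeFn_toLp _

/-- By the two boundary identities the pairing is Cauchy's formula for `f * thetaGarabedian r a`. -/
theorem inner_thetaTrace (h0 : 0 < r) (h1 : r < 1) (ha : a ∈ annulus r) {f : ℂ → ℂ}
    {g : Lp ℂ 2 (arcLength (annulus r))} (hf : IsSmoothHolomorphic (annulus r) f)
    (hg : g =ᵐ[arcLength (annulus r)] f) :
    inner ℂ (thetaTrace h0 h1 ha) g = unitCircleLength * thetaGarabedian r a a * f a := by
  have hT := isSmoothHolomorphic_thetaSzego h0 h1 ha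
  have hB := isSmoothHolomorphic_thetaGarabedian h0 h1 ha
  rw [inner_eq_circleAverage h0 h1 hT.continuousOn_frontier hf.continuousOn_frontier
    (thetaTrace_ae_eq h0 h1 ha) hg]
  have e1 : Real.circleAverage (fun z => f z * star (thetaSzego r a z)) 0 1 =
      Real.circleAverage (fun z => f z * thetaGarabedian r a z * (z / (z - a))) 0 1 := by
    refine Real.circleAverage_congr_sphere fun z hz => ?_
    simp only [star_thetaSzego_of_norm_eq_one h0 h1 ha (by simpa using hz), mul_assoc]
  have e2 : Real.circleAverage (fun z => f z * star (thetaSzego r a z)) 0 r =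
      -(r : ℂ)⁻¹ * Real.circleAverage (fun z => f z * thetaGarabedian r a z * (z / (z - a))) 0 r := by
    have := Real.circleAverage_fun_smul (a := -(r : ℂ)⁻¹)
      (f := fun z : ℂ => f z * thetaGarabedian r a z * (z / (z - a))) (c := 0) (R := r)
    rw [smul_eq_mul] at this
    rw [← this]
    refine Real.circleAverage_congr_sphere fun z hz => ?_
    simp only [star_thetaSzego_of_norm_eq h0 h1 ha (by simpa [abs_of_pos h0] using hz), smul_eq_mul]
    ring
  have hc := hf.2.continuousOn.mul hB.2.continuousOn
  rw [closure_annulus h0 h1] at hc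
  have hcauchy := cauchy_formula_annulus h0 hc (hf.1.mul hB.1) ha.1 ha.2
  have hr0 : (r : ℂ) ≠ 0 := by exact_mod_cast h0.ne'
  rw [e1, e2]
  simp only [Pi.mul_apply] at hcauchy
  rw [mul_assoc (unitCircleLength : ℂ), mul_comm (thetaGarabedian r a a), ← hcauchy]
  field_simp
  ring

theorem thetaGarabedian_self_ne_zero (h0 : 0 < r) (h1 : r < 1) (ha : a ∈ annulus r) :
    thetaGarabedian r a a ≠ 0 :=
  thetaGarabedian_ne_zero h0 h1 (closure_annulus_subset_thetaDomain h0 h1 ha (subset_closure ha))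

theorem unitCircleLength_mul_szegoDiagonal (h0 : 0 < r) (h1 : r < 1) (ha : a ∈ annulus r) :
    unitCircleLength * szegoDiagonal (annulus r) a =
      ‖thetaSzego r a a‖ / ‖thetaGarabedian r a a‖ := by
  have hC := unitCircleLength_pos
  have hC' : (unitCircleLength : ℂ) ≠ 0 := by exact_mod_cast hC.ne'
  have hB := thetaGarabedian_self_ne_zero h0 h1 ha
  have hT := isSmoothHolomorphic_thetaSzego h0 h1 ha
  -- The constant normalizes `inner_thetaTrace`; it is conjugated because it enters the
  -- conjugate-linear slot.
  set c : ℂ := star (unitCircleLength * thetaGarabedian r a a : ℂ)⁻¹ with hc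
  have hk : RepresentsEvaluation (annulus r) a (c • thetaTrace h0 h1 ha) := by
    constructor
    · exact Submodule.smul_mem _ _ ((smoothTraces (annulus r)).le_topologicalClosure
        ⟨_, hT, thetaTrace_ae_eq h0 h1 ha⟩)
    · intro f g hf hg
      rw [inner_smul_left, inner_thetaTrace h0 h1 ha hf hg, hc, Complex.star_def, Complex.conj_conj]
      field_simp
  have hself : inner ℂ (c • thetaTrace h0 h1 ha) (c • thetaTrace h0 h1 ha) =
      c * thetaSzego r a a := by
    rw [inner_smul_right, hk.2 _ _ hT (thetaTrace_ae_eq h0 h1 ha)]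
  have hn : szegoDiagonal (annulus r) a = ‖c * thetaSzego r a a‖ := by
    rw [szegoDiagonal, szegoKernel, hk.szegoRepresenter_eq, ← hself]
    exact inner_self_re_eq_norm (𝕜 := ℂ) (c • thetaTrace h0 h1 ha)
  rw [hn, norm_mul, hc, norm_star, norm_inv, norm_mul, Complex.norm_real, Real.norm_of_nonneg hC.le]
  have := norm_ne_zero_iff.mpr hB
  field_simp

/-! ### The extremal problem of the Carathéodory metric. -/

/-- The quotient of the Szegő and the Garabedian kernels of the annulus, up to a constant factor
the extremal function of the Carathéodory metric. -/
noncomputable def ahlforsFunction (r : ℝ) (a z : ℂ) : ℂ :=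
  (z - a) * (thetaSzego r a z / thetaGarabedian r a z)

theorem differentiableOn_thetaQuotient (h0 : 0 < r) (h1 : r < 1) :
    DifferentiableOn ℂ (fun z => thetaSzego r a z / thetaGarabedian r a z) (thetaDomain r a) :=
  (differentiableOn_thetaSzego h0 h1).div (differentiableOn_thetaGarabedian h0 h1)
    fun _ hz => thetaGarabedian_ne_zero h0 h1 hz

theorem deriv_ahlforsFunction (h0 : 0 < r) (h1 : r < 1) (ha : a ∈ annulus r) :
    deriv (ahlforsFunction r a) a = thetaSzego r a a / thetaGarabedian r a a := by
  have hmem := closure_annulus_subset_thetaDomain h0 h1 ha (subset_closure ha)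
  have hd := ((differentiableOn_thetaQuotient h0 h1).differentiableAt
    ((isOpen_thetaDomain r a).mem_nhds hmem)).hasDerivAt
  have := ((hasDerivAt_id a).sub_const a).mul hd
  have h2 := this.deriv
  simp only [id, sub_self, zero_mul, one_mul, add_zero] at h2
  exact h2

/-- By the boundary identities the function is unimodular on both circles; the maximum principle
does the rest. -/
theorem norm_ahlforsFunction_le (h0 : 0 < r) (h1 : r < 1) (ha : a ∈ annulus r) {z : ℂ}
    (hz : z ∈ annulus r) : ‖ahlforsFunction r a z‖ ≤ 1 := by
  have hsub := closure_annulus_subset_thetaDomain h0 h1 ha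
  have hd : DifferentiableOn ℂ (ahlforsFunction r a) (thetaDomain r a) :=
    (differentiableOn_id.sub_const a).mul (differentiableOn_thetaQuotient h0 h1)
  refine Complex.norm_le_of_forall_mem_frontier_norm_le
    (annulus_isSmoothlyBounded h0 h1).isBounded ?_ (fun w hw => ?_) (subset_closure hz)
  · exact (hd.mono hsub).diffContOnCl
  · have hwB := thetaGarabedian_ne_zero h0 h1 (hsub (frontier_subset_closure hw))
    rw [ahlforsFunction, norm_mul, norm_div, ← norm_star (thetaSzego r a w)]
    rw [frontier_annulus h0 h1] at hw
    have hB := norm_ne_zero_iff.mpr hwB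
    rcases hw with hw | hw
    · have hw : ‖w‖ = 1 := by simpa using hw
      have hwa : ‖w - a‖ ≠ 0 :=
        norm_ne_zero_iff.mpr fun h => by rw [sub_eq_zero.mp h] at hw; exact ha.2.ne hw
      rw [star_thetaSzego_of_norm_eq_one h0 h1 ha hw, norm_mul, norm_div, hw]
      field_simp
      exact le_rfl
    · have hw : ‖w‖ = r := by simpa using hw
      have hwa : ‖w - a‖ ≠ 0 :=
        norm_ne_zero_iff.mpr fun h => by rw [sub_eq_zero.mp h] at hw; exact ha.1.ne' hw
      rw [star_thetaSzego_of_norm_eq h0 h1 ha hw, norm_mul, norm_mul, norm_div, hw, norm_neg,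
        norm_inv, Complex.norm_real, Real.norm_of_nonneg h0.le]
      field_simp
      exact le_rfl

theorem norm_circleAverage_le {R : ℝ} (hR : 0 ≤ R) {F : ℂ → ℂ} {W : ℂ → ℝ}
    (hW : ContinuousOn W (Metric.sphere 0 R))
    (h : ∀ z ∈ Metric.sphere (0 : ℂ) R, ‖F z‖ ≤ W z) :
    ‖Real.circleAverage F 0 R‖ ≤ Real.circleAverage W 0 R := by
  have hpi : (0 : ℝ) ≤ 2 * Real.pi := by positivity
  have hmem : ∀ θ, circleMap 0 R θ ∈ Metric.sphere (0 : ℂ) R := fun θ =>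
    circleMap_mem_sphere 0 hR θ
  rw [Real.circleAverage, Real.circleAverage, norm_smul, smul_eq_mul,
    Real.norm_of_nonneg (inv_nonneg.mpr hpi)]
  gcongr
  refine intervalIntegral.norm_integral_le_of_norm_le hpi
    (.of_forall fun θ _ => h _ (hmem θ)) ?_
  exact (hW.comp_continuous (continuous_circleMap 0 R) hmem).intervalIntegrable _ _

/-- The modulus of the square of the Garabedian kernel, up to a constant factor. -/
noncomputable def garabedianWeight (r : ℝ) (a z : ℂ) : ℝ :=
  ‖thetaGarabedian r a z * (z / (z - a))‖ ^ 2 / ‖z‖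

theorem continuousOn_garabedianWeight (h0 : 0 < r) (h1 : r < 1) (ha : a ∈ annulus r) :
    ContinuousOn (garabedianWeight r a) (closure (annulus r) \ {a}) := by
  have hB := ((isSmoothHolomorphic_thetaGarabedian h0 h1 ha).2.continuousOn).mono
    (sdiff_subset : closure (annulus r) \ {a} ⊆ closure (annulus r))
  refine ((hB.mul ?_).norm.pow 2).div continuousOn_id.norm ?_
  · exact continuousOn_id.div (continuousOn_id.sub continuousOn_const) fun z hz =>
      sub_ne_zero.mpr hz.2
  · exact fun z hz => norm_ne_zero_iff.mpr (ne_zero_of_mem_closure_annulus h0 h1 hz.1)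

/-- On the boundary the weight is `‖thetaSzego r a z‖ ^ 2` times the radius of the circle, so the
left side is the squared norm of the trace divided by `unitCircleLength`. Reproduction of
`thetaSzego` itself evaluates it. -/
theorem circleAverage_garabedianWeight (h0 : 0 < r) (h1 : r < 1) (ha : a ∈ annulus r) :
    Real.circleAverage (garabedianWeight r a) 0 1 + Real.circleAverage (garabedianWeight r a) 0 r =
      ‖thetaGarabedian r a a * thetaSzego r a a‖ := by
  have hC := unitCircleLength_pos
  have hT := isSmoothHolomorphic_thetaSzego h0 h1 ha
  have h2 := inner_thetaTrace h0 h1 ha hT (thetaTrace_ae_eq h0 h1 ha)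
  rw [inner_eq_circleAverage h0 h1 hT.continuousOn_frontier hT.continuousOn_frontier
    (thetaTrace_ae_eq h0 h1 ha) (thetaTrace_ae_eq h0 h1 ha), mul_assoc] at h2
  have hC' : (unitCircleLength : ℂ) ≠ 0 := by exact_mod_cast hC.ne'
  have h3 := mul_left_cancel₀ hC' h2
  have hsph : ∀ R : ℝ, R = 1 ∨ R = r → Metric.sphere (0 : ℂ) R ⊆ frontier (annulus r) := by
    rw [frontier_annulus h0 h1]
    rintro R (rfl | rfl)
    · exact subset_union_left
    · exact subset_union_right
  have hcast : ∀ R : ℝ, R = 1 ∨ R = r →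
      Real.circleAverage (fun z => thetaSzego r a z * star (thetaSzego r a z)) 0 R =
        ((Real.circleAverage (fun z => ‖thetaSzego r a z‖ ^ 2) 0 R : ℝ) : ℂ) := by
    intro R hR
    have hR0 : 0 ≤ R := by rcases hR with rfl | rfl <;> linarith
    have := Complex.ofRealCLM.circleAverage_comp_comm (c := 0) (R := R)
      (f := fun z => ‖thetaSzego r a z‖ ^ 2)
      (((hT.continuousOn_frontier.mono (hsph R hR)).norm.pow 2).circleIntegrable hR0)
    rw [Complex.ofRealCLM_apply] at this
    rw [← this]
    congr 1
    funext z
    rw [Complex.star_def, Complex.mul_conj, Complex.normSq_eq_norm_sq]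
    rfl
  rw [hcast 1 (Or.inl rfl), hcast r (Or.inr rfl)] at h3
  have e1 : Real.circleAverage (garabedianWeight r a) 0 1 =
      Real.circleAverage (fun z => ‖thetaSzego r a z‖ ^ 2) 0 1 := by
    refine Real.circleAverage_congr_sphere fun z hz => ?_
    have hz : ‖z‖ = 1 := by simpa using hz
    simp only [garabedianWeight]
    rw [← norm_star (thetaSzego r a z), star_thetaSzego_of_norm_eq_one h0 h1 ha hz, hz, div_one]
  have e2 : Real.circleAverage (garabedianWeight r a) 0 r =
      r * Real.circleAverage (fun z => ‖thetaSzego r a z‖ ^ 2) 0 r := by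
    rw [← smul_eq_mul, ← Real.circleAverage_fun_smul]
    refine Real.circleAverage_congr_sphere fun z hz => ?_
    have hz : ‖z‖ = r := by simpa [abs_of_pos h0] using hz
    simp only [garabedianWeight]
    rw [← norm_star (thetaSzego r a z), star_thetaSzego_of_norm_eq h0 h1 ha hz, hz,
      norm_mul (-(r : ℂ)⁻¹), norm_neg, norm_inv, Complex.norm_real, Real.norm_of_nonneg h0.le, smul_eq_mul]
    field_simp
  have hnn : ∀ R : ℝ, 0 ≤ Real.circleAverage (fun z => ‖thetaSzego r a z‖ ^ 2) 0 R := fun R =>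
    Real.circleAverage_nonneg_of_nonneg fun z _ => by positivity
  rw [e1, e2, ← h3]
  rw [← Complex.ofReal_mul, ← Complex.ofReal_add, Complex.norm_real, Real.norm_of_nonneg]
  exact add_nonneg (hnn 1) (mul_nonneg h0.le (hnn r))

/-- Cauchy's formula for `dslope f a * thetaGarabedian ^ 2` yields `deriv f a * thetaGarabedian r a
a ^ 2`. Since `‖f‖ ≤ 1`, the integrand is bounded by `garabedianWeight`, whose boundary averages are
known. -/
theorem norm_deriv_le_of_mapsTo_ball (h0 : 0 < r) (h1 : r < 1) (ha : a ∈ annulus r) {f : ℂ → ℂ}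
    (hf : DifferentiableOn ℂ f (annulus r)) (hmaps : MapsTo f (annulus r) (Metric.ball 0 1))
    (hfa : f a = 0) : ‖deriv f a‖ ≤ ‖thetaSzego r a a‖ / ‖thetaGarabedian r a a‖ := by
  have hB := isSmoothHolomorphic_thetaGarabedian h0 h1 ha
  have hW := continuousOn_garabedianWeight h0 h1 ha
  have hfd : DifferentiableAt ℂ f a := hf.differentiableAt ((isOpen_annulus r).mem_nhds ha)
  have hbound : ∀ ρ₁ ∈ Ioo r ‖a‖, ∀ ρ₂ ∈ Ioo ‖a‖ 1, ‖deriv f a * thetaGarabedian r a a ^ 2‖ ≤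
      Real.circleAverage (garabedianWeight r a) 0 ρ₂ +
        Real.circleAverage (garabedianWeight r a) 0 ρ₁ := by
    intro ρ₁ hρ₁ ρ₂ hρ₂
    have hsub : {z : ℂ | ρ₁ ≤ ‖z‖ ∧ ‖z‖ ≤ ρ₂} ⊆ annulus r := fun z hz =>
      ⟨hρ₁.1.trans_le hz.1, hz.2.trans_lt hρ₂.2⟩
    have hd : DifferentiableOn ℂ (fun z => dslope f a z * thetaGarabedian r a z ^ 2) (annulus r) :=
      ((Complex.differentiableOn_dslope ((isOpen_annulus r).mem_nhds ha)).mpr hf).mul (hB.1.pow 2)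
    have hcauchy := cauchy_formula_annulus (h0.trans hρ₁.1) (hd.mono hsub).continuousOn
      (hd.mono fun z hz => hsub ⟨hz.1.le, hz.2.le⟩) hρ₁.2 hρ₂.1
    rw [dslope_same] at hcauchy
    rw [← hcauchy]
    have hest : ∀ R : ℝ, ρ₁ ≤ R → R ≤ ρ₂ → R ≠ ‖a‖ →
        ‖Real.circleAverage (fun z => dslope f a z * thetaGarabedian r a z ^ 2 * (z / (z - a))) 0 R‖
          ≤ Real.circleAverage (garabedianWeight r a) 0 R := by
      intro R hR1 hR2 hRa
      have hmem : ∀ z ∈ Metric.sphere (0 : ℂ) R, z ∈ annulus r ∧ z ≠ a := by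
        intro z hz
        rw [mem_sphere_zero_iff_norm] at hz
        exact ⟨hsub ⟨by rw [hz]; exact hR1, by rw [hz]; exact hR2⟩,
          fun h => hRa (by rw [← hz, h])⟩
      refine norm_circleAverage_le ((h0.trans hρ₁.1).le.trans hR1)
        (hW.mono fun z hz => ⟨subset_closure (hmem z hz).1, (hmem z hz).2⟩) fun z hz => ?_
      obtain ⟨hzA, hza⟩ := hmem z hz
      have hz0 : 0 < ‖z‖ := h0.trans hzA.1
      have hza' : 0 < ‖z - a‖ := norm_pos_iff.mpr (sub_ne_zero.mpr hza)
      have hfz : ‖f z‖ ≤ 1 := by simpa using (mem_ball_zero_iff.mp (hmaps hzA)).le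
      rw [dslope_of_ne f hza, slope_def_field, hfa, sub_zero, garabedianWeight]
      simp only [norm_mul, norm_div, norm_pow]
      calc ‖f z‖ / ‖z - a‖ * ‖thetaGarabedian r a z‖ ^ 2 * (‖z‖ / ‖z - a‖)
          ≤ 1 / ‖z - a‖ * ‖thetaGarabedian r a z‖ ^ 2 * (‖z‖ / ‖z - a‖) := by gcongr
        _ = _ := by field_simp
    exact (norm_sub_le _ _).trans (add_le_add (hest ρ₂ (hρ₁.2.trans hρ₂.1).le le_rfl hρ₂.1.ne')
      (hest ρ₁ le_rfl (hρ₁.2.trans hρ₂.1).le hρ₁.2.ne))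
  -- As `f` has no boundary values, the estimate is made on interior circles. Its right side no
  -- longer involves `f` and is continuous up to the boundary radii.
  have hc2 : ContinuousOn (Real.circleAverage (garabedianWeight r a) 0) (Ioc ‖a‖ 1) := by
    refine Real.ContinuousOn.circleAverage (hW.mono fun z hz => ?_)
      fun R hR => (norm_nonneg a).trans hR.1.le
    rw [mem_ofPred_eq, sub_zero] at hz
    rw [closure_annulus h0 h1]
    exact ⟨⟨(ha.1.trans hz.1).le, hz.2⟩, fun h => hz.1.ne (by rw [h])⟩
  have hc1 : ContinuousOn (Real.circleAverage (garabedianWeight r a) 0) (Ico r ‖a‖) := by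
    refine Real.ContinuousOn.circleAverage (hW.mono fun z hz => ?_) fun R hR => h0.le.trans hR.1
    rw [mem_ofPred_eq, sub_zero] at hz
    rw [closure_annulus h0 h1]
    exact ⟨⟨hz.1, (hz.2.trans ha.2).le⟩, fun h => hz.2.ne (by rw [h])⟩
  have step1 : ∀ ρ₁ ∈ Ioo r ‖a‖, ‖deriv f a * thetaGarabedian r a a ^ 2‖ ≤
      Real.circleAverage (garabedianWeight r a) 0 1 +
        Real.circleAverage (garabedianWeight r a) 0 ρ₁ := by
    intro ρ₁ hρ₁
    have hne : (𝓝[Ioo ‖a‖ 1] (1 : ℝ)).NeBot := right_nhdsWithin_Ioo_neBot ha.2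
    exact ge_of_tendsto (((hc2 1 ⟨ha.2, le_rfl⟩).mono Ioo_subset_Ioc_self).tendsto.add_const _)
      (eventually_nhdsWithin_of_forall fun ρ₂ hρ₂ => hbound ρ₁ hρ₁ ρ₂ hρ₂)
  have step2 : ‖deriv f a * thetaGarabedian r a a ^ 2‖ ≤
      Real.circleAverage (garabedianWeight r a) 0 1 +
        Real.circleAverage (garabedianWeight r a) 0 r := by
    have hne : (𝓝[Ioo r ‖a‖] r).NeBot := left_nhdsWithin_Ioo_neBot ha.1
    exact ge_of_tendsto (((hc1 r ⟨le_rfl, ha.1⟩).mono Ioo_subset_Ico_self).tendsto.const_add _)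
      (eventually_nhdsWithin_of_forall fun ρ₁ hρ₁ => step1 ρ₁ hρ₁)
  rw [circleAverage_garabedianWeight h0 h1 ha, norm_mul, norm_mul, norm_pow] at step2
  have hb : 0 < ‖thetaGarabedian r a a‖ := norm_pos_iff.mpr (thetaGarabedian_self_ne_zero h0 h1 ha)
  rw [le_div_iff₀ hb]
  nlinarith

theorem caratheodoryMetric_annulus (h0 : 0 < r) (h1 : r < 1) (ha : a ∈ annulus r) :
    caratheodoryMetric (annulus r) a = szegoMoment r 0 (Real.log ‖a‖) := by
  have hC := unitCircleLength_pos
  have hS := unitCircleLength_mul_szegoDiagonal h0 h1 ha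
  rw [szegoDiagonal_annulus h0 h1 ha, mul_inv_cancel_left₀ hC.ne'] at hS
  rw [hS]
  have hsub := closure_annulus_subset_thetaDomain h0 h1 ha
  have hd : DifferentiableOn ℂ (ahlforsFunction r a) (thetaDomain r a) :=
    (differentiableOn_id.sub_const a).mul (differentiableOn_thetaQuotient h0 h1)
  have hlub : IsLUB {t : ℝ | ∃ f : ℂ → ℂ, DifferentiableOn ℂ f (annulus r) ∧
      MapsTo f (annulus r) (Metric.ball 0 1) ∧ f a = 0 ∧ t = ‖deriv f a‖}
      (‖thetaSzego r a a‖ / ‖thetaGarabedian r a a‖) := by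
    constructor
    · rintro t ⟨f, hf, hm, hfa, rfl⟩
      exact norm_deriv_le_of_mapsTo_ball h0 h1 ha hf hm hfa
    · intro b hb
      -- The extremal function is only known to be bounded by 1, whereas competitors map into the
      -- open disc; scaling by `s < 1` and letting `s → 1` bridges this.
      have hscaled : ∀ s ∈ Ioo (0 : ℝ) 1, s * (‖thetaSzego r a a‖ / ‖thetaGarabedian r a a‖) ≤ b := by
        intro s hs
        refine hb ⟨fun z => (s : ℂ) * ahlforsFunction r a z, ?_, ?_, ?_, ?_⟩
        · exact (hd.mono (subset_closure.trans hsub)).const_mul _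
        · intro z hz
          rw [mem_ball_zero_iff, norm_mul, Complex.norm_real, Real.norm_of_nonneg hs.1.le]
          nlinarith [norm_ahlforsFunction_le h0 h1 ha hz, hs.1, hs.2]
        · simp [ahlforsFunction]
        · have hda := hd.differentiableAt ((isOpen_thetaDomain r a).mem_nhds
            (hsub (subset_closure ha)))
          rw [deriv_const_mul _ hda, deriv_ahlforsFunction h0 h1 ha, norm_mul, Complex.norm_real,
            Real.norm_of_nonneg hs.1.le, norm_div]
      have hne : (𝓝[Ioo (0 : ℝ) 1] (1 : ℝ)).NeBot := right_nhdsWithin_Ioo_neBot one_pos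
      have ht : Tendsto (fun s : ℝ => s * (‖thetaSzego r a a‖ / ‖thetaGarabedian r a a‖))
          (𝓝[Ioo (0 : ℝ) 1] 1) (𝓝 (1 * (‖thetaSzego r a a‖ / ‖thetaGarabedian r a a‖))) :=
        (tendsto_id.mono_left nhdsWithin_le_nhds).mul_const _
      rw [one_mul] at ht
      exact le_of_tendsto ht (eventually_nhdsWithin_of_forall hscaled)
  refine hlub.csSup_eq ⟨_, fun _ => 0, differentiableOn_const 0, fun z _ => ?_, rfl, rfl⟩
  simp

end

/-! ### The two metrics and their curvatures on an annulus -/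

section

variable {r : ℝ} {z : ℂ}

theorem log_norm_mem_Ioo (h0 : 0 < r) (hz : z ∈ annulus r) :
    Real.log ‖z‖ ∈ Ioo (Real.log r) 0 :=
  ⟨Real.log_lt_log h0 hz.1, Real.log_neg (h0.trans hz.1) hz.2⟩

theorem isConformalMetricOn_caratheodoryMetric (h0 : 0 < r) (h1 : r < 1) :
    IsConformalMetricOn (caratheodoryMetric (annulus r)) (annulus r) := by
  constructor
  · exact (contDiffOn_comp_log_norm (n := 2) h0 (contDiffOn_szegoMoment h0 2 0)).congr fun z hz =>
      caratheodoryMetric_annulus h0 h1 hz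
  · intro z hz
    rw [caratheodoryMetric_annulus h0 h1 hz]
    exact szegoMoment_zero_pos h0 (log_norm_mem_Ioo h0 hz)

theorem gaussianCurvature_caratheodoryMetric (h0 : 0 < r) (h1 : r < 1) (hz : z ∈ annulus r) :
    gaussianCurvature (caratheodoryMetric (annulus r)) z =
      -(4 * szegoVariance r (Real.log ‖z‖) / ‖z‖ ^ 2) / szegoMoment r 0 (Real.log ‖z‖) ^ 2 := by
  have hu := log_norm_mem_Ioo h0 hz
  rw [gaussianCurvature, caratheodoryMetric_annulus h0 h1 hz,
    laplacian_comp_log_norm (φ := fun u => Real.log (szegoMoment r 0 u))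
      (norm_pos_iff.mp (h0.trans hz.1)) ?_ ?_ (hasDerivAt_two_mul_szegoMean_one h0 hu)]
  · filter_upwards [(isOpen_annulus r).mem_nhds hz] with w hw
    rw [caratheodoryMetric_annulus h0 h1 hw]
  · filter_upwards [isOpen_Ioo.mem_nhds hu] with u hu
    exact hasDerivAt_log_szegoMoment_zero h0 hu

/-- The factor `1 / ‖z‖` is written `exp (-log ‖z‖)` so that the metric is again a function of `log
‖z‖`. -/
theorem szegoMetric_annulus (h0 : 0 < r) (h1 : r < 1) (hz : z ∈ annulus r) :
    szegoMetric (annulus r) z = √(szegoVariance r (Real.log ‖z‖)) * Real.exp (-Real.log ‖z‖) := by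
  have hu := log_norm_mem_Ioo h0 hz
  have hz0 : 0 < ‖z‖ := h0.trans hz.1
  have hC := unitCircleLength_pos
  rw [szegoMetric, wirtinger_comp_log_norm (c := 4 * szegoVariance r (Real.log ‖z‖))
    (φ := fun u => Real.log unitCircleLength⁻¹ + Real.log (szegoMoment r 0 u))
      (norm_pos_iff.mp hz0) ?_ ?_ (hasDerivAt_two_mul_szegoMean_one h0 hu)]
  · rw [mul_div_mul_left _ _ four_ne_zero, Real.sqrt_div' _ (by positivity), Real.sqrt_sq hz0.le,
      Real.exp_neg, Real.exp_log hz0, div_eq_mul_inv]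
  · filter_upwards [(isOpen_annulus r).mem_nhds hz] with w hw
    rw [szegoDiagonal_annulus h0 h1 hw, Real.log_mul (inv_ne_zero hC.ne')
      (szegoMoment_zero_pos h0 (log_norm_mem_Ioo h0 hw)).ne']
  · filter_upwards [isOpen_Ioo.mem_nhds hu] with u hu
    exact (hasDerivAt_log_szegoMoment_zero h0 hu).const_add _

theorem isConformalMetricOn_szegoMetric (h0 : 0 < r) (h1 : r < 1) :
    IsConformalMetricOn (szegoMetric (annulus r)) (annulus r) := by
  constructor
  · refine (contDiffOn_comp_log_norm (n := 2) h0
      (φ := fun u => √(szegoVariance r u) * Real.exp (-u)) ?_).congr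
      fun z hz => szegoMetric_annulus h0 h1 hz
    exact ((contDiffOn_szegoVariance h0 2).sqrt fun u hu => (szegoVariance_pos h0 hu).ne').mul
      (Real.contDiff_exp.comp contDiff_neg).contDiffOn
  · intro z hz
    rw [szegoMetric_annulus h0 h1 hz]
    exact mul_pos (Real.sqrt_pos.mpr (szegoVariance_pos h0 (log_norm_mem_Ioo h0 hz)))
      (Real.exp_pos _)

/-- With `u = log ‖z‖`, the logarithm of the metric is `(1 / 2) * log V - u`, with derivative `K₃ /
V - 1`. The second derivative and the squared metric both carry `‖z‖⁻²`, which cancels. -/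
theorem gaussianCurvature_szegoMetric (h0 : 0 < r) (h1 : r < 1) (hz : z ∈ annulus r) :
    gaussianCurvature (szegoMetric (annulus r)) z =
      -2 * (szegoCumulantFour r (Real.log ‖z‖) / szegoVariance r (Real.log ‖z‖) -
        (szegoCumulantThree r (Real.log ‖z‖) / szegoVariance r (Real.log ‖z‖)) ^ 2) /
        szegoVariance r (Real.log ‖z‖) := by
  have hu := log_norm_mem_Ioo h0 hz
  have hz0 : 0 < ‖z‖ := h0.trans hz.1
  have hV := szegoVariance_pos h0 hu
  have hd : HasDerivAt (fun u => szegoCumulantThree r u / szegoVariance r u - 1) _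
      (Real.log ‖z‖) :=
    ((hasDerivAt_szegoCumulantThree h0 hu).div (hasDerivAt_szegoVariance h0 hu) hV.ne').sub_const 1
  rw [gaussianCurvature, szegoMetric_annulus h0 h1 hz,
    laplacian_comp_log_norm (φ := fun u => 1 / 2 * Real.log (szegoVariance r u) - u)
      (norm_pos_iff.mp hz0) ?_ ?_ hd]
  · rw [mul_pow, Real.sq_sqrt hV.le, Real.exp_neg, Real.exp_log hz0]
    field_simp
  · filter_upwards [(isOpen_annulus r).mem_nhds hz] with w hw
    have hVw := szegoVariance_pos h0 (log_norm_mem_Ioo h0 hw)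
    rw [szegoMetric_annulus h0 h1 hw, Real.log_mul (Real.sqrt_pos.mpr hVw).ne' (Real.exp_pos _).ne',
      Real.log_exp, Real.log_sqrt hVw.le]
    ring
  · filter_upwards [isOpen_Ioo.mem_nhds hu] with u hu
    have hVu := szegoVariance_pos h0 hu
    refine ((((hasDerivAt_szegoVariance h0 hu).log hVu.ne').const_mul (1 / 2)).sub
      (hasDerivAt_id u)).congr_deriv ?_
    ring

end

/-! ### Asymptotics as the inner radius tends to zero -/

theorem szegoTerm_pow_log {s : ℝ} (hs : 0 < s) (p : ℕ) (n : ℤ) :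
    szegoTerm (s ^ p) (Real.log s) n = (1 + (s ^ p) ^ (2 * n + 1))⁻¹ * s ^ (2 * n) := by
  rw [szegoTerm]
  congr 1
  have : 2 * (n : ℝ) * Real.log s = Real.log (s ^ (2 * n)) := by
    rw [Real.log_zpow]; push_cast; ring
  rw [this, Real.exp_log (by positivity)]

theorem szegoTerm_pow_log_natCast_le {s : ℝ} (hs : 0 < s) (p n : ℕ) :
    szegoTerm (s ^ p) (Real.log s) n ≤ s ^ (2 * n) := by
  refine (szegoTerm_natCast_le (pow_pos hs p) _ n).trans_eq ?_
  rw [two_mul, Real.exp_add, Real.exp_log hs, ← sq, pow_mul]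

/-- The exponent of `r` is `k + 2`; the cases used are `k = 0` for `r = s ^ 2` and `k = 2` for `r =
s ^ 4`. -/
theorem szegoTerm_pow_log_negSucc_le {s : ℝ} (hs : 0 < s) (k m : ℕ) :
    szegoTerm (s ^ (k + 2)) (Real.log s) (Int.negSucc m) ≤ s ^ ((2 * k + 2) * m + k) := by
  have h := szegoTerm_neg_natCast_le (pow_pos hs (k + 2)) (Real.log s) (m + 1)
  refine h.trans_eq ?_
  have h2 : Real.exp (-2 * Real.log s) = (s ^ 2)⁻¹ := by
    rw [neg_mul, Real.exp_neg, two_mul, Real.exp_add, Real.exp_log hs, sq]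
  have h3 : (s ^ (k + 2)) ^ 2 * (s ^ 2)⁻¹ = s ^ (2 * k + 2) := by
    field_simp; ring
  rw [h2, h3, ← pow_mul, inv_mul_eq_iff_eq_mul₀ (by positivity), ← pow_add]
  congr 1
  ring

/-- Dominated convergence with one majorant that serves all the moments below. -/
theorem tendsto_tsum_int_of_le {F : ℝ → ℤ → ℝ} {l : ℤ → ℝ} (j : ℕ)
    (hF : ∀ n, Tendsto (fun s => F s n) (𝓝[>] 0) (𝓝 (l n)))
    (hb : ∀ s ∈ Ioo (0 : ℝ) (1 / 2), ∀ n : ℤ, |F s n| ≤ |(n : ℝ)| ^ j * (4 * (1 / 4) ^ n.natAbs)) :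
    Tendsto (fun s => ∑' n, F s n) (𝓝[>] 0) (𝓝 (∑' n, l n)) := by
  have hg : Summable fun n : ℕ => (n : ℝ) ^ j * (4 * (1 / 4) ^ n) := by
    refine ((summable_pow_mul_geometric_of_norm_lt_one j (r := (1 / 4 : ℝ))
      (by norm_num)).mul_left 4).congr fun n => ?_
    ring
  refine tendsto_tsum_of_dominated_convergence
    (bound := fun n : ℤ => |(n : ℝ)| ^ j * (4 * (1 / 4) ^ n.natAbs)) ?_ hF ?_
  · apply Summable.of_nat_of_neg <;> simpa using hg
  · filter_upwards [Ioo_mem_nhdsGT (show (0 : ℝ) < 1 / 2 by norm_num)] with s hs n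
    exact hb s hs n

theorem tendsto_pow_nhdsGT_zero {k : ℕ} (hk : k ≠ 0) :
    Tendsto (fun s : ℝ => s ^ k) (𝓝[>] 0) (𝓝 0) := by
  have : Tendsto (fun s : ℝ => s ^ k) (𝓝 0) (𝓝 (0 ^ k)) := (continuous_pow k).tendsto 0
  rw [zero_pow hk] at this
  exact this.mono_left nhdsWithin_le_nhds

/-- In the worst cases the term of index `n` is bounded only by `s ^ (2 * |n| - 2)`; the lost factor
`s ^ 2` costs the constant 4 when `s < 1 / 2`. -/
theorem pow_le_four_mul {s : ℝ} (hs : s ∈ Ioo (0 : ℝ) (1 / 2)) {k n : ℕ} (h : 2 * n ≤ k + 2) :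
    s ^ k ≤ 4 * (1 / 4) ^ n := by
  have h1 : s ^ k ≤ (1 / 2) ^ k := by
    have := hs.1.le
    have := hs.2.le
    gcongr
  have h2 : (1 / 2 : ℝ) ^ (k + 2) ≤ (1 / 2) ^ (2 * n) :=
    pow_le_pow_of_le_one (by norm_num) (by norm_num) h
  have h3 : (1 / 2 : ℝ) ^ (2 * n) = (1 / 4) ^ n := by rw [pow_mul]; norm_num
  rw [h3, pow_add] at h2
  linarith

theorem tendsto_inv_one_add_pow {k : ℕ} (hk : k ≠ 0) :
    Tendsto (fun s : ℝ => (1 + s ^ k)⁻¹) (𝓝[>] 0) (𝓝 1) := by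
  have := ((tendsto_pow_nhdsGT_zero hk).const_add 1).inv₀ (by norm_num)
  simpa using this

theorem tendsto_zero_of_le_pow {F : ℝ → ℝ} {k : ℕ} (hk : k ≠ 0)
    (h0 : ∀ s, 0 < s → 0 ≤ F s) (h : ∀ s, 0 < s → F s ≤ s ^ k) : Tendsto F (𝓝[>] 0) (𝓝 0) :=
  tendsto_of_tendsto_of_tendsto_of_le_of_le' tendsto_const_nhds (tendsto_pow_nhdsGT_zero hk)
    (eventually_nhdsWithin_of_forall h0) (eventually_nhdsWithin_of_forall h)

/-- The weight at 0 and the weight at -1 are both exactly `1 / (1 + s ^ 2)`; every other weight is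
bounded by a positive power of `s`. With `0 ^ 0 = 1` the limit also covers the total mass. -/
theorem tendsto_szegoMoment_sq (j : ℕ) :
    Tendsto (fun s : ℝ => szegoMoment (s ^ 2) j (Real.log s)) (𝓝[>] 0)
      (𝓝 (0 ^ j + (-1) ^ j)) := by
  have hl : ∑' n : ℤ, (n : ℝ) ^ j * (if n = 0 ∨ n = -1 then 1 else 0) = 0 ^ j + (-1) ^ j := by
    rw [tsum_eq_sum (s := {0, -1})]
    · rw [Finset.sum_pair (by decide)]; simp
    · intro n hn
      rw [if_neg (by simpa using hn), mul_zero]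
  rw [← hl]
  refine tendsto_tsum_int_of_le j (fun n => Tendsto.const_mul _ ?_) ?_
  · rcases n with n | m
    · rcases Nat.eq_zero_or_pos n with rfl | hn
      · simp only [Int.ofNat_eq_natCast, Nat.cast_zero, true_or, if_true]
        refine (tendsto_inv_one_add_pow two_ne_zero).congr' ?_
        filter_upwards [self_mem_nhdsWithin] with s hs
        rw [szegoTerm_pow_log hs]; simp
      · rw [if_neg (by simp; omega)]
        exact tendsto_zero_of_le_pow (k := 2 * n) (by omega)
          (fun s hs => (szegoTerm_pos (pow_pos hs 2) _ _).le)
          (fun s hs => szegoTerm_pow_log_natCast_le hs 2 n)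
    · rcases Nat.eq_zero_or_pos m with rfl | hm
      · rw [if_pos (by simp)]
        refine (tendsto_inv_one_add_pow two_ne_zero).congr' ?_
        filter_upwards [self_mem_nhdsWithin] with s hs
        have hs : 0 < s := hs
        rw [szegoTerm_pow_log hs]
        simp only [Int.reduceNegSucc, Int.reduceMul, Int.reduceAdd, zpow_neg, zpow_one]
        norm_cast
        field_simp
        ring
      · rw [if_neg (by omega)]
        exact tendsto_zero_of_le_pow (k := 2 * m) (by omega)
          (fun s hs => (szegoTerm_pos (pow_pos hs 2) _ _).le)
          (fun s hs => (szegoTerm_pow_log_negSucc_le hs 0 m).trans_eq (by simp))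
  · intro s hs n
    rw [abs_mul, abs_pow, abs_of_pos (szegoTerm_pos (pow_pos hs.1 2) _ n)]
    gcongr
    rcases n with n | m
    · exact (szegoTerm_pow_log_natCast_le hs.1 2 n).trans (pow_le_four_mul hs (by simp))
    · exact (szegoTerm_pow_log_negSucc_le hs.1 0 m).trans (pow_le_four_mul hs (by simp; omega))

theorem tendsto_szegoMoment_zero_pow_four :
    Tendsto (fun s : ℝ => szegoMoment (s ^ 4) 0 (Real.log s)) (𝓝[>] 0) (𝓝 1) := by
  have hl : ∑' n : ℤ, (n : ℝ) ^ 0 * (if n = 0 then 1 else 0) = 1 := by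
    simp
  rw [← hl]
  refine tendsto_tsum_int_of_le 0 (fun n => Tendsto.const_mul _ ?_) ?_
  · rcases n with n | m
    · rcases Nat.eq_zero_or_pos n with rfl | hn
      · rw [if_pos (by simp)]
        refine (tendsto_inv_one_add_pow four_ne_zero).congr' ?_
        filter_upwards [self_mem_nhdsWithin] with s hs
        rw [szegoTerm_pow_log hs]; simp
      · rw [if_neg (by simp; omega)]
        exact tendsto_zero_of_le_pow (k := 2 * n) (by omega)
          (fun s hs => (szegoTerm_pos (pow_pos hs 4) _ _).le)
          (fun s hs => szegoTerm_pow_log_natCast_le hs 4 n)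
    · rw [if_neg (by omega)]
      exact tendsto_zero_of_le_pow (k := (2 * 2 + 2) * m + 2) (by omega)
        (fun s hs => (szegoTerm_pos (pow_pos hs 4) _ _).le)
        (fun s hs => szegoTerm_pow_log_negSucc_le hs 2 m)
  · intro s hs n
    rw [abs_mul, abs_pow, abs_of_pos (szegoTerm_pos (pow_pos hs.1 4) _ n)]
    gcongr
    rcases n with n | m
    · exact (szegoTerm_pow_log_natCast_le hs.1 4 n).trans (pow_le_four_mul hs (by simp))
    · exact (szegoTerm_pow_log_negSucc_le hs.1 2 m).trans (pow_le_four_mul hs (by simp; omega))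

/-- The leading weights off the origin are `s ^ 2 / (1 + s ^ 12)` at 1 and `s ^ 2 / (1 + s ^ 4)` at
-1. -/
theorem tendsto_szegoMoment_pow_four_div {j : ℕ} (hj : j ≠ 0) :
    Tendsto (fun s : ℝ => szegoMoment (s ^ 4) j (Real.log s) / s ^ 2) (𝓝[>] 0)
      (𝓝 (1 + (-1) ^ j)) := by
  have hl : ∑' n : ℤ, (n : ℝ) ^ j * (if n = 1 ∨ n = -1 then 1 else 0) = 1 + (-1) ^ j := by
    rw [tsum_eq_sum (s := {1, -1})]
    · rw [Finset.sum_pair (by decide)]; simp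
    · intro n hn
      rw [if_neg (by simpa using hn), mul_zero]
  rw [← hl]
  simp only [szegoMoment, ← tsum_div_const]
  have hnat : ∀ s : ℝ, 0 < s → ∀ n : ℕ,
      szegoTerm (s ^ 4) (Real.log s) ((n + 1 : ℕ) : ℤ) / s ^ 2 ≤ s ^ (2 * n) := by
    intro s hs n
    rw [div_le_iff₀ (by positivity), ← pow_add]
    exact szegoTerm_pow_log_natCast_le hs 4 (n + 1)
  have hneg : ∀ s : ℝ, 0 < s → ∀ m : ℕ,
      szegoTerm (s ^ 4) (Real.log s) (Int.negSucc m) / s ^ 2 ≤ s ^ (6 * m) := by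
    intro s hs m
    rw [div_le_iff₀ (by positivity), ← pow_add]
    exact szegoTerm_pow_log_negSucc_le hs 2 m
  have hpos : ∀ s : ℝ, 0 < s → ∀ n, 0 < szegoTerm (s ^ 4) (Real.log s) n / s ^ 2 := fun s hs n =>
    div_pos (szegoTerm_pos (pow_pos hs 4) _ n) (by positivity)
  simp only [mul_div_assoc]
  refine tendsto_tsum_int_of_le j (fun n => ?_) ?_
  · rcases n with n | m
    · rcases n with _ | n
      -- The weight at 0 blows up after division by `s ^ 2`, but the factor `0 ^ j` removes it.
      · simp [zero_pow hj]
      · refine Tendsto.const_mul _ ?_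
        rcases Nat.eq_zero_or_pos n with rfl | hn
        · rw [if_pos (by simp)]
          refine (tendsto_inv_one_add_pow (k := 12) (by norm_num)).congr' ?_
          filter_upwards [self_mem_nhdsWithin] with s hs
          have hs : 0 < s := hs
          rw [szegoTerm_pow_log hs]
          simp only [zero_add, Int.ofNat_eq_natCast, Nat.cast_one, mul_one, Int.reduceAdd]
          norm_cast
          rw [← pow_mul]
          field_simp
        · rw [if_neg (by simp; omega)]
          exact tendsto_zero_of_le_pow (k := 2 * n) (by omega)
            (fun s hs => (hpos s hs _).le) (fun s hs => hnat s hs n)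
    · refine Tendsto.const_mul _ ?_
      rcases Nat.eq_zero_or_pos m with rfl | hm
      · rw [if_pos (by simp)]
        refine (tendsto_inv_one_add_pow four_ne_zero).congr' ?_
        filter_upwards [self_mem_nhdsWithin] with s hs
        have hs : 0 < s := hs
        rw [szegoTerm_pow_log hs]
        simp only [Int.reduceNegSucc, Int.reduceMul, Int.reduceAdd, zpow_neg, zpow_one]
        norm_cast
        field_simp
        ring
      · rw [if_neg (by omega)]
        exact tendsto_zero_of_le_pow (k := 6 * m) (by omega)
          (fun s hs => (hpos s hs _).le) (fun s hs => hneg s hs m)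
  · intro s hs n
    rw [abs_mul, abs_pow, abs_of_pos (hpos s hs.1 n)]
    rcases n with n | m
    · rcases n with _ | n
      · simp [zero_pow hj]
      · gcongr
        exact (hnat s hs.1 n).trans (pow_le_four_mul hs (by simp; omega))
    · gcongr
      exact (hneg s hs.1 m).trans (pow_le_four_mul hs (by simp; omega))

/-! ### Divergence of the two curvatures. -/

theorem tendsto_neg_mul_inv_sq_atBot {F : ℝ → ℝ} {l : ℝ} (hl : l < 0)
    (hF : Tendsto F (𝓝[>] 0) (𝓝 l)) :
    Tendsto (fun s : ℝ => F s * (s ^ 2)⁻¹) (𝓝[>] 0) atBot := by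
  refine hF.neg_mul_atTop hl ?_
  refine Tendsto.inv_tendsto_nhdsGT_zero ?_
  exact tendsto_nhdsWithin_iff.mpr ⟨tendsto_pow_nhdsGT_zero two_ne_zero,
    eventually_nhdsWithin_of_forall fun s (hs : 0 < s) => pow_pos hs 2⟩

theorem ofReal_mem_annulus_pow {s : ℝ} (hs : s ∈ Ioo (0 : ℝ) 1) {p : ℕ} (hp : 1 < p) :
    (s : ℂ) ∈ annulus (s ^ p) := by
  have hn : ‖(s : ℂ)‖ = s := by rw [Complex.norm_real, Real.norm_of_nonneg hs.1.le]
  change s ^ p < ‖(s : ℂ)‖ ∧ ‖(s : ℂ)‖ < 1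
  rw [hn]
  exact ⟨pow_lt_self_of_lt_one₀ hs.1 hs.2 hp, hs.2⟩

theorem tendsto_gaussianCurvature_caratheodoryMetric_sq :
    Tendsto (fun s : ℝ => gaussianCurvature (caratheodoryMetric (annulus (s ^ 2))) (s : ℂ))
      (𝓝[>] 0) atBot := by
  have h0 := tendsto_szegoMoment_sq 0
  have h1 := tendsto_szegoMoment_sq 1
  have h2 := tendsto_szegoMoment_sq 2
  have hne : (0 : ℝ) ^ 0 + (-1) ^ 0 ≠ 0 := by norm_num
  have hV : Tendsto (fun s : ℝ => szegoVariance (s ^ 2) (Real.log s)) (𝓝[>] 0) (𝓝 (1 / 4)) := by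
    have := (h2.div h0 hne).sub ((h1.div h0 hne).pow 2)
    norm_num at this
    exact this
  -- The remaining factor `(s ^ 2)⁻¹` of the curvature is `1 / ‖z‖ ^ 2`; this limit equals `-1 / 4`.
  have hK := ((hV.const_mul (-4)).div (h0.pow 2) (pow_ne_zero 2 hne))
  refine (tendsto_neg_mul_inv_sq_atBot (by norm_num) hK).congr' ?_
  filter_upwards [Ioo_mem_nhdsGT (show (0 : ℝ) < 1 by norm_num)] with s hs
  have hn : ‖(s : ℂ)‖ = s := by rw [Complex.norm_real, Real.norm_of_nonneg hs.1.le]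
  rw [gaussianCurvature_caratheodoryMetric (pow_pos hs.1 2)
    (pow_lt_one₀ hs.1.le hs.2 two_ne_zero) (ofReal_mem_annulus_pow hs one_lt_two), hn]
  simp only [Pi.div_apply]
  ring

theorem tendsto_gaussianCurvature_szegoMetric_pow_four :
    Tendsto (fun s : ℝ => gaussianCurvature (szegoMetric (annulus (s ^ 4))) (s : ℂ))
      (𝓝[>] 0) atBot := by
  have hM0 := tendsto_szegoMoment_zero_pow_four
  have hm : ∀ j : ℕ, j ≠ 0 → Tendsto (fun s : ℝ => szegoMean (s ^ 4) j (Real.log s) / s ^ 2)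
      (𝓝[>] 0) (𝓝 (1 + (-1) ^ j)) := by
    intro j hj
    have := (tendsto_szegoMoment_pow_four_div hj).div hM0 one_ne_zero
    rw [div_one] at this
    refine this.congr fun s => ?_
    simp only [Pi.div_apply, szegoMean]
    ring
  have m1 := hm 1 (by norm_num)
  have m2 := hm 2 (by norm_num)
  have m3 := hm 3 (by norm_num)
  have m4 := hm 4 (by norm_num)
  norm_num at m1 m2 m3 m4
  -- Each mean is `O(s ^ 2)`, so after division by `s ^ 2` every product of means in a cumulant
  -- keeps a positive power of `s`. The cumulants thus have the limits of the raw means: 2 in even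
  -- order, 0 in odd order.
  have hs2 := tendsto_pow_nhdsGT_zero two_ne_zero
  have hs4 := tendsto_pow_nhdsGT_zero four_ne_zero
  have hs6 := tendsto_pow_nhdsGT_zero (k := 6) (by norm_num)
  have hV : Tendsto (fun s : ℝ => szegoVariance (s ^ 4) (Real.log s) / s ^ 2) (𝓝[>] 0) (𝓝 2) := by
    have := m2.sub ((m1.pow 2).mul hs2)
    norm_num at this
    refine this.congr' ?_
    filter_upwards [self_mem_nhdsWithin] with s hs
    have hs : s ≠ 0 := (show 0 < s from hs).ne'
    rw [szegoVariance]
    field_simp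
  have h3 : Tendsto (fun s : ℝ => szegoCumulantThree (s ^ 4) (Real.log s) / s ^ 2) (𝓝[>] 0)
      (𝓝 0) := by
    have := (m3.sub (((m1.const_mul 3).mul m2).mul hs2)).add (((m1.pow 3).const_mul 2).mul hs4)
    norm_num at this
    refine this.congr' ?_
    filter_upwards [self_mem_nhdsWithin] with s hs
    have hs : s ≠ 0 := (show 0 < s from hs).ne'
    rw [szegoCumulantThree]
    field_simp
  have h4 : Tendsto (fun s : ℝ => szegoCumulantFour (s ^ 4) (Real.log s) / s ^ 2) (𝓝[>] 0)
      (𝓝 2) := by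
    have := (((m4.sub (((m1.const_mul 4).mul m3).mul hs2)).sub (((m2.pow 2).const_mul 3).mul
      hs2)).add ((((m1.pow 2).const_mul 12).mul m2).mul hs4)).sub (((m1.pow 4).const_mul 6).mul hs6)
    norm_num at this
    refine this.congr' ?_
    filter_upwards [self_mem_nhdsWithin] with s hs
    have hs : s ≠ 0 := (show 0 < s from hs).ne'
    rw [szegoCumulantFour]
    field_simp
  -- The limit is `-1`; the missing factor `(s ^ 2)⁻¹` comes from dividing by the variance.
  have hK := (((h4.div hV two_ne_zero).sub ((h3.div hV two_ne_zero).pow 2)).const_mul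
    (-2)).div hV two_ne_zero
  refine (tendsto_neg_mul_inv_sq_atBot (by norm_num) hK).congr' ?_
  filter_upwards [Ioo_mem_nhdsGT (show (0 : ℝ) < 1 by norm_num)] with s hs
  have hn : ‖(s : ℂ)‖ = s := by rw [Complex.norm_real, Real.norm_of_nonneg hs.1.le]
  have hmem := ofReal_mem_annulus_pow hs (show 1 < 4 by norm_num)
  have hVp := szegoVariance_pos (pow_pos hs.1 4) (log_norm_mem_Ioo (pow_pos hs.1 4) hmem)
  rw [gaussianCurvature_szegoMetric (pow_pos hs.1 4) (pow_lt_one₀ hs.1.le hs.2 four_ne_zero) hmem]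
  rw [hn] at hVp ⊢
  have hs0 := hs.1.ne'
  simp only [Pi.div_apply]
  field_simp

/-! ### Return from `s` to the radius `r`, and the main theorem. -/

theorem tendsto_rpow_nhdsGT_zero {x : ℝ} (hx : 0 < x) :
    Tendsto (fun r : ℝ => r ^ x) (𝓝[>] 0) (𝓝[>] 0) := by
  refine tendsto_nhdsWithin_iff.mpr ⟨?_, eventually_nhdsWithin_of_forall fun r hr =>
    Real.rpow_pos_of_pos hr x⟩
  have := (Real.continuousAt_rpow_const 0 x (Or.inr hx.le)).tendsto
  rw [Real.zero_rpow hx.ne'] at this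
  exact this.mono_left nhdsWithin_le_nhds

theorem exists_lt_of_tendsto_atBot {F : ℝ → ℝ} (hF : Tendsto F (𝓝[>] 0) atBot) (M : ℝ) :
    ∃ r ∈ Ioo (0 : ℝ) 1, F r < M := by
  obtain ⟨r, hr1, hr2⟩ := ((eventually_mem_set.mpr
    (Ioo_mem_nhdsGT (show (0 : ℝ) < 1 by norm_num))).and (hF.eventually_lt_atBot M)).exists
  exact ⟨r, hr1, hr2⟩

theorem mainTheorem8 :
    -- no universal lower bound for the curvature of the Carathéodory metric
    (¬ ∃ M : ℝ, ∀ Ω : Set ℂ, IsSmoothlyBoundedDomain Ω → ∀ z ∈ Ω,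
      M ≤ gaussianCurvature (caratheodoryMetric Ω) z) ∧
    -- no universal lower bound for the curvature of the Szegő metric
    (¬ ∃ M : ℝ, ∀ Ω : Set ℂ, IsSmoothlyBoundedDomain Ω → ∀ z ∈ Ω,
      M ≤ gaussianCurvature (szegoMetric Ω) z) ∧
    -- the witnesses are annuli
    (∀ r ∈ Set.Ioo (0 : ℝ) 1, IsSmoothlyBoundedDomain (annulus r) ∧
      IsConformalMetricOn (caratheodoryMetric (annulus r)) (annulus r) ∧
      IsConformalMetricOn (szegoMetric (annulus r)) (annulus r)) ∧
    Filter.Tendsto (fun r : ℝ =>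
        gaussianCurvature (caratheodoryMetric (annulus r)) ((r ^ (1 / 2 : ℝ) : ℝ) : ℂ))
      (nhdsWithin 0 (Set.Ioi 0)) Filter.atBot ∧
    Filter.Tendsto (fun r : ℝ =>
        gaussianCurvature (szegoMetric (annulus r)) ((r ^ (1 / 4 : ℝ) : ℝ) : ℂ))
      (nhdsWithin 0 (Set.Ioi 0)) Filter.atBot := by
  have hC : Tendsto (fun r : ℝ =>
      gaussianCurvature (caratheodoryMetric (annulus r)) ((r ^ (1 / 2 : ℝ) : ℝ) : ℂ))
      (𝓝[>] 0) atBot := by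
    refine (tendsto_gaussianCurvature_caratheodoryMetric_sq.comp
      (tendsto_rpow_nhdsGT_zero (x := 1 / 2) (by norm_num))).congr' ?_
    filter_upwards [self_mem_nhdsWithin] with r hr
    have h : (r ^ (1 / 2 : ℝ)) ^ 2 = r := by
      rw [← Real.rpow_mul_natCast (le_of_lt hr)]; norm_num
    simp only [Function.comp_apply, h]
  have hS : Tendsto (fun r : ℝ =>
      gaussianCurvature (szegoMetric (annulus r)) ((r ^ (1 / 4 : ℝ) : ℝ) : ℂ))
      (𝓝[>] 0) atBot := by
    refine (tendsto_gaussianCurvature_szegoMetric_pow_four.comp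
      (tendsto_rpow_nhdsGT_zero (x := 1 / 4) (by norm_num))).congr' ?_
    filter_upwards [self_mem_nhdsWithin] with r hr
    have h : (r ^ (1 / 4 : ℝ)) ^ 4 = r := by
      rw [← Real.rpow_mul_natCast (le_of_lt hr)]; norm_num
    simp only [Function.comp_apply, h]
  refine ⟨?_, ?_, ?_, hC, hS⟩
  · rintro ⟨M, hM⟩
    obtain ⟨s, hs, hlt⟩ :=
      exists_lt_of_tendsto_atBot tendsto_gaussianCurvature_caratheodoryMetric_sq M
    exact hlt.not_ge (hM _ (annulus_isSmoothlyBounded (pow_pos hs.1 2)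
      (pow_lt_one₀ hs.1.le hs.2 two_ne_zero)) _ (ofReal_mem_annulus_pow hs one_lt_two))
  · rintro ⟨M, hM⟩
    obtain ⟨s, hs, hlt⟩ :=
      exists_lt_of_tendsto_atBot tendsto_gaussianCurvature_szegoMetric_pow_four M
    exact hlt.not_ge (hM _ (annulus_isSmoothlyBounded (pow_pos hs.1 4)
      (pow_lt_one₀ hs.1.le hs.2 four_ne_zero)) _ (ofReal_mem_annulus_pow hs (by norm_num)))
  · exact fun r hr => ⟨annulus_isSmoothlyBounded hr.1 hr.2,
      isConformalMetricOn_caratheodoryMetric hr.1 hr.2, isConformalMetricOn_szegoMetric hr.1 hr.2⟩
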